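/- Let $n \ge 2$ and let $\mu$ be the probability measure on $\mathbb{U}(2^n)$ describing one step of the uniform random circuit on $n$ qubits: a pair of indices $i \neq j$ in $\{1,\dots,n\}$ is chosen uniformly at random, and a two-qubit gate drawn from the Haar measure on $\mathbb{U}(4)$ is applied to qubits $i$ and $j$ (and the identity to the other qubits). Let $\mu^{*k}$ be the $k$-fold convolution of $\mu$, i.e. the law of a uniform random circuit of size $k$, the product of $k$ independent such steps. For a measure $\nu$ on $\mathbb{U}(d)$ put $$\mathcal{G}_{\nu,t}(\rho) = \int_{\mathbb{U}(d)} U^{\otimes t}\,\rho\,(U^\dagger)^{\otimes t}\,\nu(dU),$$ and write $\mathcal{G}_{H,t}$ for the case where $\nu$ is the Haar probability measure. Call $\nu$ an $\varepsilon$-approximate unitary $t$-design if $$\|\mathcal{G}_{\nu,t} - \mathcal{G}_{H,t}\|_{2\to 2} := \sup_{X \neq 0} \frac{\|\mathcal{G}_{\nu,t}(X) - \mathcal{G}_{H,t}(X)\|_2}{\|X\|_2} \le \varepsilon, \qquad \|X\|_2 = (\operatorname{tr} X^\dagger X)^{1/2}.$$ Proposition. For every $\varepsilon > 0$ and every integer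 $k \ge 0$ with $k \ge 5 n^2 \log(1/\varepsilon)$ ($\log$ the natural logarithm), the uniform random circuit of size $k$ on $n$ qubits, i.e. the measure $\mu^{*k}$ on $\mathbb{U}(2^n)$, is an $\varepsilon$-approximate unitary 3-design. -/

import Mathlib

open MeasureTheory
open scoped Matrix Kronecker ENNReal

noncomputable section

namespace RandomCircuit

/-! ### The unitary group and its Haar probability measure -/

section Unitary

variable (ι : Type*) [Fintype ι] [DecidableEq ι]

/-- The group `𝕌(d)` of unitary matrices whose rows and columns are indexed by the basis labels
`ι` (so `d = |ι|`), with the topology inherited from the matrices. -/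
abbrev U : Type _ := Matrix.unitaryGroup ι ℂ

instance instMeasurableSpaceU : MeasurableSpace (U ι) := borel _

instance instBorelSpaceU : BorelSpace (U ι) := ⟨rfl⟩

instance instCompactSpaceU : CompactSpace (U ι) := by
  refine isCompact_iff_compactSpace.1 (?_ : IsCompact {A : Matrix ι ι ℂ | A ∈ Matrix.unitaryGroup ι ℂ})
  have hK : IsCompact (Set.pi Set.univ fun _ : ι => Set.pi Set.univ fun _ : ι =>
      Metric.closedBall (0 : ℂ) 1) :=
    isCompact_univ_pi fun _ => isCompact_univ_pi fun _ => isCompact_closedBall _ _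
  refine IsCompact.of_isClosed_subset (X := Matrix ι ι ℂ) hK isClosed_unitary ?_
  intro A hA i _ j _
  simpa using entry_norm_bound_of_unitary hA i j

instance instSecondCountableU : SecondCountableTopology (U ι) := by
  have : SecondCountableTopology (Matrix ι ι ℂ) :=
    inferInstanceAs (SecondCountableTopology (ι → ι → ℂ))
  exact TopologicalSpace.Subtype.secondCountableTopology _

/-- The Haar measure of `𝕌(d)`, normalised to total mass one. -/
def haar : Measure (U ι) := Measure.haarMeasure ⊤

instance instIsProbabilityMeasureHaar : IsProbabilityMeasure (haar ι) :=
  ⟨by simpa [haar] using (Measure.haarMeasure_self (K₀ := (⊤ : TopologicalSpace.PositiveCompacts (U ι))))⟩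

end Unitary

/-! ### Approximate unitary designs -/

section Design

variable {ι : Type*} [Fintype ι] [DecidableEq ι]

/-- The tensor power `A^{⊗ t}`, a matrix over the product basis labelled by `Fin t → ι`. -/
def tensorPower (t : ℕ) (A : Matrix ι ι ℂ) : Matrix (Fin t → ι) (Fin t → ι) ℂ :=
  Matrix.of fun x y => ∏ s, A (x s) (y s)

/-- The superoperator `𝒢_{μ,t}(ρ) = ∫ U^{⊗ t} ρ (U†)^{⊗ t} μ(dU)`; the matrix-valued integral is
taken entry by entry. -/
def twirl (μ : Measure (U ι)) (t : ℕ) (ρ : Matrix (Fin t → ι) (Fin t → ι) ℂ) :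
    Matrix (Fin t → ι) (Fin t → ι) ℂ :=
  Matrix.of fun x y => ∫ V, (tensorPower t V.1 * ρ * tensorPower t (V.1)ᴴ) x y ∂μ

/-- The Schatten 2-norm `‖X‖₂ = (tr |X|²)^{1/2}`, with `|X|² = X† X`. -/
def schattenTwo {κ : Type*} [Fintype κ] (X : Matrix κ κ ℂ) : ℝ :=
  Real.sqrt (Xᴴ * X).trace.re

/-- The induced norm `‖Λ‖_{2 → 2} = sup_{X ≠ 0} ‖Λ(X)‖₂ / ‖X‖₂` of a superoperator; it is valued
in `[0, ∞]`, so that the supremum always exists. -/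
def normTwoTwo {κ : Type*} [Fintype κ] (Λ : Matrix κ κ ℂ → Matrix κ κ ℂ) : ℝ≥0∞ :=
  ⨆ (X : Matrix κ κ ℂ) (_ : X ≠ 0), ENNReal.ofReal (schattenTwo (Λ X) / schattenTwo X)

/-- The ensemble `{μ, U}` is an `ε`-approximate unitary `t`-design:
`‖𝒢_{μ,t} - 𝒢_{H,t}‖_{2 → 2} ≤ ε`. -/
def IsApproxUnitaryDesign (μ : Measure (U ι)) (t : ℕ) (ε : ℝ) : Prop :=
  normTwoTwo (fun ρ => twirl μ t ρ - twirl (haar ι) t ρ) ≤ ENNReal.ofReal ε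

end Design

/-! ### Uniform random circuits -/

section Circuit

variable {n : ℕ}

/-- A computational basis label of `n` qubits; matrices over these labels are the operators on
`(ℂ²)^{⊗ n}`. -/
abbrev Bits (n : ℕ) : Type := Fin n → Fin 2

/-- The two-qubit operator `A` applied to qubits `i` and `j` (in this order), tensored with the
identity on the other qubits. -/
def onPair (i j : Fin n) (A : Matrix (Fin 2 × Fin 2) (Fin 2 × Fin 2) ℂ) :
    Matrix (Bits n) (Bits n) ℂ :=
  Matrix.of fun x y =>
    if ∀ k, k ≠ i → k ≠ j → x k = y k then A (x i, x j) (y i, y j) else 0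

/-- Splitting a basis label into its bits at `i`, `j` and the remaining ones. -/
def splitBits (i j : Fin n) (h : i ≠ j) :
    Bits n ≃ (Fin 2 × Fin 2) × ({k : Fin n // k ≠ i ∧ k ≠ j} → Fin 2) where
  toFun x := ((x i, x j), fun k => x k)
  invFun p := fun k =>
    if hi : k = i then p.1.1 else if hj : k = j then p.1.2 else p.2 ⟨k, hi, hj⟩
  left_inv x := by
    funext k
    by_cases hi : k = i
    · simp [hi]
    · by_cases hj : k = j
      · subst hj; simp [hi]
      · simp [hi, hj]
  right_inv p := by
    obtain ⟨⟨a, b⟩, c⟩ := p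
    ext k
    · simp
    · simp [h.symm]
    · simp [k.2.1, k.2.2]

theorem onPair_eq_submatrix (i j : Fin n) (h : i ≠ j)
    (A : Matrix (Fin 2 × Fin 2) (Fin 2 × Fin 2) ℂ) :
    onPair i j A = (A ⊗ₖ (1 : Matrix ({k : Fin n // k ≠ i ∧ k ≠ j} → Fin 2) _ ℂ)).submatrix
      (splitBits i j h) (splitBits i j h) := by
  ext x y
  by_cases hxy : ∀ k, k ≠ i → k ≠ j → x k = y k
  · have hz : (splitBits i j h x).2 = (splitBits i j h y).2 :=
      funext fun k => hxy k k.2.1 k.2.2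
    simp only [onPair, Matrix.of_apply, if_pos hxy, Matrix.submatrix_apply,
      Matrix.kroneckerMap_apply, Matrix.one_apply, if_pos hz, mul_one]
    rfl
  · have hz : (splitBits i j h x).2 ≠ (splitBits i j h y).2 :=
      fun H => hxy fun k hi hj => congrFun H ⟨k, hi, hj⟩
    simp only [onPair, Matrix.of_apply, if_neg hxy, Matrix.submatrix_apply,
      Matrix.kroneckerMap_apply, Matrix.one_apply, if_neg hz, mul_zero]

theorem onPair_mem_unitaryGroup (i j : Fin n) (h : i ≠ j) (V : U (Fin 2 × Fin 2)) :
    onPair i j V.1 ∈ Matrix.unitaryGroup (Bits n) ℂ := by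
  have hk := Matrix.kronecker_mem_unitary V.2
    (one_mem (unitary (Matrix ({k : Fin n // k ≠ i ∧ k ≠ j} → Fin 2) _ ℂ)))
  have h2 := Matrix.mem_unitaryGroup_iff.1 hk
  rw [Matrix.mem_unitaryGroup_iff, onPair_eq_submatrix i j h, Matrix.star_eq_conjTranspose,
    Matrix.conjTranspose_submatrix, Matrix.submatrix_mul_equiv, ← Matrix.star_eq_conjTranspose, h2,
    Matrix.submatrix_one_equiv]

/-- The gate `U_{i,j}`: the unitary `V ∈ 𝕌(4)` applied to the distinct qubits `i` and `j`. -/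
def gate (p : {p : Fin n × Fin n // p.1 ≠ p.2}) (V : U (Fin 2 × Fin 2)) : U (Bits n) :=
  ⟨onPair p.1.1 p.1.2 V.1, onPair_mem_unitaryGroup _ _ p.2 V⟩

theorem measurable_gate (p : {p : Fin n × Fin n // p.1 ≠ p.2}) : Measurable (gate p) := by
  refine Continuous.measurable (Continuous.subtype_mk ?_ _)
  refine continuous_pi fun x => continuous_pi fun y => ?_
  simp only [onPair, Matrix.of_apply]
  split_ifs
  · exact (continuous_apply_apply _ _).comp continuous_subtype_val
  · exact continuous_const

variable (n)

/-- The law on `𝕌(2ⁿ)` of one step of the uniform random circuit: a pair of indices `i ≠ j` is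
chosen uniformly at random, and a Haar-random element of `𝕌(4)` is applied to qubits `i`, `j`. -/
def stepLaw : Measure (U (Bits n)) :=
  (Fintype.card {p : Fin n × Fin n // p.1 ≠ p.2} : ℝ≥0∞)⁻¹ •
    ∑ p : {p : Fin n × Fin n // p.1 ≠ p.2}, (haar (Fin 2 × Fin 2)).map (gate p)

/-- The law of a uniform random circuit with `k` gates: the `k`-fold convolution `μ^{*k}` of the
law `μ` of one step, that is, the law of the product of `k` independent steps. -/
def uniformRandomCircuit : ℕ → Measure (U (Bits n))
  | 0 => Measure.dirac 1
  | k + 1 => Measure.mconv (stepLaw n) (uniformRandomCircuit k)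

variable {n}

theorem isProbabilityMeasure_stepLaw (hn : 2 ≤ n) : IsProbabilityMeasure (stepLaw n) := by
  have hp : ∀ p : {p : Fin n × Fin n // p.1 ≠ p.2},
      ((haar (Fin 2 × Fin 2)).map (gate p)) Set.univ = 1 := fun p =>
    (Measure.isProbabilityMeasure_map (measurable_gate p).aemeasurable).measure_univ
  have hne : Nonempty {p : Fin n × Fin n // p.1 ≠ p.2} :=
    ⟨⟨(⟨0, by omega⟩, ⟨1, by omega⟩), by simp⟩⟩
  constructor
  simp only [stepLaw, Measure.smul_apply, Measure.finsetSum_apply, hp, Finset.sum_const,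
    Finset.card_univ, smul_eq_mul, nsmul_eq_mul, mul_one]
  exact ENNReal.inv_mul_cancel (by exact_mod_cast Fintype.card_ne_zero) (ENNReal.natCast_ne_top _)

theorem isProbabilityMeasure_uniformRandomCircuit (hn : 2 ≤ n) (k : ℕ) :
    IsProbabilityMeasure (uniformRandomCircuit n k) := by
  have := isProbabilityMeasure_stepLaw hn
  induction k with
  | zero => exact Measure.dirac.isProbabilityMeasure
  | succ k ih => unfold uniformRandomCircuit; infer_instance

end Circuit

end RandomCircuit

end

/-! Sorting entries by qubits (`vecEquiv`) identifies operators on three copies with vectors of an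
`n`-fold tensor product, the Schatten norm with the Hilbert norm, and conjugation by `V^{⊗ 3}` with
a unitary map. A Haar twirl is then the orthogonal projection onto the fixed operators
(`integral_haar_conjMap`). One step of the circuit is the average of such projections over ordered
pairs of qubits, and `k` steps are its `k`-th power. It acts as the identity on the globally fixed
operators, so it suffices that it contracts squared norms on their complement by `1 - 1/n²`: then
`(1 - 1/n²)^k ≤ exp (-k/n²) ≤ ε²`.

By Schur–Weyl duality (`exists_eq_sum_tensorPerm`), an operator fixed by all gates on `i, j` lies in
`permSpan qubitPerm {i, j}`, the span of a permutation of the copies on these two qubits times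
anything elsewhere. By Cauchy–Schwarz the contraction follows from a spectral gap: the squared
distances to the pair spans sum to at least `(n - 1)/n` times the squared distance to the span for
all qubits (`norm_sub_starProjection_sq_le_pairDefect`).

The gap is proved by induction on the number `m` of places, comparing the span of `A` with those of
the sets `A.erase k`. On the complement of the former, the sum of the `m` projections onto the
latter has no eigenvalue above `1 + (m - 1) * overlapBound m`
(`eq_zero_of_sum_starProjection_eq_smul`). Pairing an eigenvector with product vectors yields a
linear recursion whose coefficients come from the Gram matrix of the six permutations; a maximum
argument bounds the eigenvalue. The overlap decays like `2^(-m)`, fast enough for the induction to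
close. -/

noncomputable section

namespace RandomCircuit

/-! ### Gram matrices of the permutations of three letters -/

/-- The least number of transpositions whose product is `σ`. -/
def permLength (σ : Equiv.Perm (Fin 3)) : ℕ :=
  if σ = 1 then 0 else if ∃ i, σ i = i then 1 else 2

theorem sum_perm_three {M : Type*} [AddCommMonoid M] (F : Equiv.Perm (Fin 3) → M) :
    ∑ σ, F σ = F 1 + (F (Equiv.swap 0 1) + (F (Equiv.swap 0 2) + (F (Equiv.swap 1 2) +
      (F (Equiv.swap 0 1 * Equiv.swap 1 2) + F (Equiv.swap 1 2 * Equiv.swap 0 1))))) := by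
  have h : (Finset.univ : Finset (Equiv.Perm (Fin 3))) =
      {1, Equiv.swap 0 1, Equiv.swap 0 2, Equiv.swap 1 2, Equiv.swap 0 1 * Equiv.swap 1 2,
        Equiv.swap 1 2 * Equiv.swap 0 1} := by decide +kernel
  rw [h, Finset.sum_insert (by decide +kernel), Finset.sum_insert (by decide +kernel),
    Finset.sum_insert (by decide +kernel), Finset.sum_insert (by decide +kernel),
    Finset.sum_insert (by decide +kernel), Finset.sum_singleton]

theorem forall_perm_three {P : Equiv.Perm (Fin 3) → Prop} (h1 : P 1) (h2 : P (Equiv.swap 0 1))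
    (h3 : P (Equiv.swap 0 2)) (h4 : P (Equiv.swap 1 2))
    (h5 : P (Equiv.swap 0 1 * Equiv.swap 1 2)) (h6 : P (Equiv.swap 1 2 * Equiv.swap 0 1))
    (σ : Equiv.Perm (Fin 3)) : P σ := by
  have h : ∀ σ : Equiv.Perm (Fin 3), σ = 1 ∨ σ = Equiv.swap 0 1 ∨ σ = Equiv.swap 0 2 ∨
      σ = Equiv.swap 1 2 ∨ σ = Equiv.swap 0 1 * Equiv.swap 1 2 ∨
      σ = Equiv.swap 1 2 * Equiv.swap 0 1 := by decide +kernel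
  rcases h σ with rfl | rfl | rfl | rfl | rfl | rfl <;> assumption

/-- Coefficients of the inverse of the Gram matrix `y ^ permLength (σ⁻¹ * τ)`. -/
def gramInv (y : ℝ) (g : Equiv.Perm (Fin 3)) : ℝ :=
  (if permLength g = 0 then 1 - 2 * y ^ 2 else if permLength g = 1 then - y else 2 * y ^ 2) /
    ((1 - y ^ 2) * (1 - 4 * y ^ 2))

/-- Coefficients expressing `x ^ permLength κ * (1 / 2) ^ permLength (g⁻¹ * κ)` as a combination of
the columns of the Gram matrix with parameter `x / 2`. -/
def gramCoeff (x : ℝ) (g h : Equiv.Perm (Fin 3)) : ℝ :=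
  if permLength g = 1 then
    if h = 1 then 1 / 2 - 3 * x ^ 2 / (2 * (4 - x ^ 2))
    else if h = g then 3 * x / (4 - x ^ 2) else 0
  else
    if h = 1 then 1 / 4 - 9 * x ^ 2 / (4 * (4 - x ^ 2))
    else if permLength h = 1 then 3 * x / (2 * (4 - x ^ 2))
    else if h = g then 3 * x ^ 2 / (2 * (4 - x ^ 2)) else - (3 * x ^ 2 / (2 * (4 - x ^ 2)))

/-- The Gram matrix acts by convolution on the group, with eigenvalues `(1 + y)(1 + 2y)`, `(1 - y)(1
- 2y)` and `1 - y²` on the trivial, sign and standard representations. Hence the two denominators.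
-/
theorem sum_gramInv (y : ℝ) (h1 : 1 - y ^ 2 ≠ 0) (h2 : 1 - 4 * y ^ 2 ≠ 0)
    (κ : Equiv.Perm (Fin 3)) :
    ∑ h, gramInv y h * y ^ permLength (h⁻¹ * κ) = if κ = 1 then 1 else 0 := by
  rw [sum_perm_three]
  revert κ
  obtain ⟨D, hD⟩ : ∃ D, D = (1 - y ^ 2) * (1 - 4 * y ^ 2) := ⟨_, rfl⟩
  have hD0 : D ≠ 0 := hD ▸ mul_ne_zero h1 h2
  apply forall_perm_three <;>
    simp +decide only [permLength, gramInv, if_true, if_false, ← hD] <;> field_simp <;>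
    simp only [hD] <;> ring

/-- These right-hand sides occur when a factor of a product vector is itself a permutation vector.
At `y = x / 2` the denominator `4 - x²` is `4 (1 - y²)`; the factor `1 - 4 y²` cancels. -/
theorem sum_gramCoeff (x : ℝ) (hx : 4 - x ^ 2 ≠ 0) (g κ : Equiv.Perm (Fin 3)) (hg : g ≠ 1) :
    ∑ h, gramCoeff x g h * (x / 2) ^ permLength (h⁻¹ * κ) =
      x ^ permLength κ * (1 / 2) ^ permLength (g⁻¹ * κ) := by
  rw [sum_perm_three]
  revert g
  apply forall_perm_three
  · simp
  all_goals
    intro _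
    revert κ
    apply forall_perm_three <;> simp +decide only [permLength, gramCoeff, if_true, if_false] <;>
      field_simp <;> ring

/-- The coefficient at `1` is left out because it will multiply the pairing with a vector of the
full permutation span, which is zero. The bound is attained when `g` is a 3-cycle. -/
theorem sum_abs_gramCoeff_le (x : ℝ) (hx0 : 0 ≤ x) (hx : x ≤ 1 / 2) (g : Equiv.Perm (Fin 3))
    (hg : g ≠ 1) :
    ∑ h ∈ Finset.univ.erase 1, |gramCoeff x g h| ≤ (9 * x + 6 * x ^ 2) / (2 * (4 - x ^ 2)) := by
  have h4 : 0 < 4 - x ^ 2 := by nlinarith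
  have ha : |3 * x / (4 - x ^ 2)| = 3 * x / (4 - x ^ 2) := abs_of_nonneg (by positivity)
  have hb : |3 * x / (2 * (4 - x ^ 2))| = 3 * x / (2 * (4 - x ^ 2)) := abs_of_nonneg (by positivity)
  have hc : |3 * x ^ 2 / (2 * (4 - x ^ 2))| = 3 * x ^ 2 / (2 * (4 - x ^ 2)) :=
    abs_of_nonneg (by positivity)
  have e1 : ∑ h ∈ Finset.univ.erase 1, |gramCoeff x g h| =
      ∑ h, if h = 1 then 0 else |gramCoeff x g h| := by
    rw [← Finset.add_sum_erase _ _ (Finset.mem_univ (1 : Equiv.Perm (Fin 3))), if_pos rfl, zero_add]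
    exact Finset.sum_congr rfl fun h hh => (if_neg (Finset.ne_of_mem_erase hh)).symm
  rw [e1, sum_perm_three]
  revert g
  apply forall_perm_three
  · simp
  all_goals
    intro _ _
    simp +decide only [gramCoeff, if_true, if_false, abs_zero, abs_neg, ha, hb, hc]
    rw [← sub_nonneg]
    field_simp
    ring_nf
    nlinarith

/-! ### Product vectors and spans of permutation operators -/

section PermSpan

variable {ι Q : Type*} [Fintype ι] [DecidableEq ι] [Fintype Q] [DecidableEq Q]

/-- The product vector `⊗ᵢ vᵢ`. -/
def prodVec (v : ι → Q → ℂ) : EuclideanSpace ℂ (ι → Q) := WithLp.toLp 2 fun z => ∏ i, v i (z i)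

theorem inner_prodVec (u v : ι → Q → ℂ) :
    inner ℂ (prodVec u) (prodVec v) = ∏ i, ∑ q, star (u i q) * v i q := by
  rw [Finset.prod_univ_sum, Fintype.piFinset_univ]
  simp only [prodVec, PiLp.inner_apply, RCLike.inner_apply, map_prod, ← Finset.prod_mul_distrib]
  refine Finset.sum_congr rfl fun z _ => Finset.prod_congr rfl fun i _ => ?_
  rw [mul_comm]; rfl

variable (p : Equiv.Perm (Fin 3) → Q → ℂ)

/-- The product vector with factors `p ρ` on `A`, except for the factor `u` at `k`, and with the
basis vectors `w i` at the other places. -/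
def mixVec (A : Finset ι) (k : ι) (u : Q → ℂ) (ρ : Equiv.Perm (Fin 3)) (w : ι → Q) :
    EuclideanSpace ℂ (ι → Q) :=
  prodVec fun i => if i = k then u else if i ∈ A then p ρ else Pi.single (w i) 1

/-- The product vector with factors `p ρ` on `A` and the basis vectors `w i` elsewhere. -/
def permVec (A : Finset ι) (ρ : Equiv.Perm (Fin 3)) (w : ι → Q) : EuclideanSpace ℂ (ι → Q) :=
  prodVec fun i => if i ∈ A then p ρ else Pi.single (w i) 1

/-- The span of the vectors `(p ρ)^{⊗ A} ⊗ v`. -/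
def permSpan (A : Finset ι) : Submodule ℂ (EuclideanSpace ℂ (ι → Q)) :=
  Submodule.span ℂ (Set.range fun a : Equiv.Perm (Fin 3) × (ι → Q) => permVec p A a.1 a.2)

theorem permVec_mem (A : Finset ι) (ρ : Equiv.Perm (Fin 3)) (w : ι → Q) :
    permVec p A ρ w ∈ permSpan p A := Submodule.subset_span ⟨(ρ, w), rfl⟩

theorem permVec_eq_mixVec {A : Finset ι} {k : ι} (hk : k ∈ A) (ρ : Equiv.Perm (Fin 3))
    (w : ι → Q) : permVec p A ρ w = mixVec p A k (p ρ) ρ w := by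
  unfold permVec mixVec
  congr 1
  funext i
  by_cases h : i = k
  · subst h; simp [hk]
  · simp [h]

theorem mixVec_eq_sum (A : Finset ι) (k : ι) (u : Q → ℂ) (ρ : Equiv.Perm (Fin 3)) (w : ι → Q) :
    mixVec p A k u ρ w = ∑ q, u q • permVec p (A.erase k) ρ (Function.update w k q) := by
  ext z
  simp only [mixVec, permVec, prodVec, WithLp.ofLp_sum, Finset.sum_apply, WithLp.ofLp_smul,
    Pi.smul_apply, smul_eq_mul]
  rw [← Finset.mul_prod_erase _ _ (Finset.mem_univ k), if_pos rfl]
  have : ∀ q, (∏ i, (if i ∈ A.erase k then p ρ else Pi.single (Function.update w k q i) 1) (z i)) =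
      (if q = z k then 1 else 0) * ∏ i ∈ Finset.univ.erase k,
        (if i = k then u else if i ∈ A then p ρ else Pi.single (w i) 1) (z i) := by
    intro q
    rw [← Finset.mul_prod_erase _ _ (Finset.mem_univ k)]
    congr 1
    · simp [Pi.single_apply, eq_comm]
    · refine Finset.prod_congr rfl fun i hi => ?_
      have := Finset.ne_of_mem_erase hi
      simp [this]
  simp only [this]
  rw [Finset.sum_eq_single (z k)]
  · simp
  · intro q _ hq; simp [hq]
  · simp

theorem mixVec_mem (A : Finset ι) (k : ι) (u : Q → ℂ) (ρ : Equiv.Perm (Fin 3)) (w : ι → Q) :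
    mixVec p A k u ρ w ∈ permSpan p (A.erase k) := by
  rw [mixVec_eq_sum]
  exact Submodule.sum_mem _ fun q _ => Submodule.smul_mem _ _ (permVec_mem p _ _ _)

theorem permSpan_le_erase (A : Finset ι) (k : ι) : permSpan p A ≤ permSpan p (A.erase k) := by
  by_cases hk : k ∈ A
  · refine Submodule.span_le.2 ?_
    rintro _ ⟨a, rfl⟩
    simp only [permVec_eq_mixVec p hk]
    exact mixVec_mem p _ _ _ _ _
  · rw [Finset.erase_eq_of_notMem hk]

variable {p}

/-- The factors at `k` and `l` are special on one side or the other; the remaining `A.card - 2`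
places of `A` each contribute one entry of the Gram matrix. -/
theorem inner_mixVec_permVec
    (hG : ∀ σ τ, ∑ q, star (p σ q) * p τ q = ((1 / 2 : ℝ) ^ permLength (σ⁻¹ * τ) : ℝ))
    {A : Finset ι} {k l : ι} (hk : k ∈ A) (hl : l ∈ A) (hkl : k ≠ l) (u : Q → ℂ)
    (ρ π : Equiv.Perm (Fin 3)) (w w' : ι → Q) :
    inner ℂ (mixVec p A k u ρ w) (permVec p (A.erase l) π w') =
      (∑ q, star (u q) * p π q) * star (p ρ (w' l)) *
        (((1 / 2 : ℝ) ^ (A.card - 2)) ^ permLength (ρ⁻¹ * π) : ℝ) *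
        ∏ i ∈ Aᶜ, if w i = w' i then 1 else 0 := by
  rw [mixVec, permVec, inner_prodVec, ← Finset.prod_mul_prod_compl A,
    ← Finset.mul_prod_erase _ _ hk, ← Finset.mul_prod_erase _ _ (Finset.mem_erase.2 ⟨hkl.symm, hl⟩),
    ← mul_assoc]
  congr 1
  · congr 1
    · congr 1
      · simp [hk, hkl]
      · simp [hkl.symm, hl, Pi.single_apply]
    · rw [Finset.prod_congr rfl (g := fun _ => (((1 / 2 : ℝ) ^ permLength (ρ⁻¹ * π) : ℝ) : ℂ))]
      · rw [Finset.prod_const, Finset.card_erase_of_mem (Finset.mem_erase.2 ⟨hkl.symm, hl⟩),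
          Finset.card_erase_of_mem hk, ← pow_mul, ← Complex.ofReal_pow, ← pow_mul, mul_comm]
        rfl
      · intro i hi
        simp only [Finset.mem_erase] at hi
        rw [← hG]
        simp [hi]
  · refine Finset.prod_congr rfl fun i hi => ?_
    rw [Finset.mem_compl] at hi
    have hik : i ≠ k := fun h => hi (h ▸ hk)
    simp only [hik, hi, if_false, Finset.mem_erase, and_false]
    simp [Pi.single_apply, eq_comm]

theorem inner_mixVec_permVec_same
    (hG : ∀ σ τ, ∑ q, star (p σ q) * p τ q = ((1 / 2 : ℝ) ^ permLength (σ⁻¹ * τ) : ℝ))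
    {A : Finset ι} {l : ι} (hl : l ∈ A) (u : Q → ℂ)
    (τ π : Equiv.Perm (Fin 3)) (w w' : ι → Q) :
    inner ℂ (mixVec p A l u τ w) (permVec p (A.erase l) π w') =
      star (u (w' l)) * (((1 / 2 : ℝ) ^ (A.card - 1)) ^ permLength (τ⁻¹ * π) : ℝ) *
        ∏ i ∈ Aᶜ, if w i = w' i then 1 else 0 := by
  rw [mixVec, permVec, inner_prodVec, ← Finset.prod_mul_prod_compl A,
    ← Finset.mul_prod_erase _ _ hl]
  congr 1
  · congr 1
    · simp [Pi.single_apply]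
    · rw [Finset.prod_congr rfl (g := fun _ => (((1 / 2 : ℝ) ^ permLength (τ⁻¹ * π) : ℝ) : ℂ))]
      · rw [Finset.prod_const, Finset.card_erase_of_mem hl, ← Complex.ofReal_pow, ← pow_mul,
          ← pow_mul, mul_comm]
      · intro i hi
        simp only [Finset.mem_erase] at hi
        rw [← hG]
        simp [hi]
  · refine Finset.prod_congr rfl fun i hi => ?_
    rw [Finset.mem_compl] at hi
    have hik : i ≠ l := fun h => hi (h ▸ hl)
    simp only [hik, hi, if_false, Finset.mem_erase, and_false]
    simp [Pi.single_apply, eq_comm]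

/-- If the pairing with `u` is the combination with coefficients `e` of Gram columns, then a test
vector for `A.erase k` acts on `permSpan p (A.erase l)` as a combination of test vectors for
`A.erase l`. -/
theorem inner_mixVec_eq_sum
    (hG : ∀ σ τ, ∑ q, star (p σ q) * p τ q = ((1 / 2 : ℝ) ^ permLength (σ⁻¹ * τ) : ℝ))
    {A : Finset ι} {k l : ι} (hk : k ∈ A) (hl : l ∈ A) (hkl : k ≠ l) (u : Q → ℂ)
    (ρ : Equiv.Perm (Fin 3)) (w : ι → Q) (e : Equiv.Perm (Fin 3) → ℂ)
    (he : ∀ π, ∑ τ, e τ * (((1 / 2 : ℝ) ^ (A.card - 1)) ^ permLength (τ⁻¹ * π) : ℝ) =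
      (((1 / 2 : ℝ) ^ (A.card - 2)) ^ permLength (ρ⁻¹ * π) : ℝ) * ∑ q, star (u q) * p π q)
    {x : EuclideanSpace ℂ (ι → Q)} (hx : x ∈ permSpan p (A.erase l)) :
    inner ℂ (mixVec p A k u ρ w) x = ∑ τ, e τ * inner ℂ (mixVec p A l (p ρ) τ w) x := by
  induction hx using Submodule.span_induction with
  | mem x hx =>
    obtain ⟨⟨π, w'⟩, rfl⟩ := hx
    -- The dependence on `w'` (at `l` and outside `A`) is the same on both sides, so only the
    -- identity in `π` supplied by `he` remains.
    simp only [inner_mixVec_permVec hG hk hl hkl, inner_mixVec_permVec_same hG hl]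
    have : ∀ a b c d : ℂ, a * (b * c * d) = (a * c) * (b * d) := fun a b c d => by ring
    simp only [this]
    rw [← Finset.sum_mul, he]
    ring
  | zero => simp
  | add x y _ _ hx hy => simp only [inner_add_right, hx, hy, mul_add, Finset.sum_add_distrib]
  | smul c x _ hx =>
    simp only [inner_smul_right, hx, Finset.mul_sum]
    exact Finset.sum_congr rfl fun τ _ => by ring

end PermSpan

/-! ### Eigenvalue bounds for sums of projections -/

/-- A symmetric map whose eigenvalues on an invariant subspace are at most `c` has Rayleigh quotient
at most `c` there. -/
theorem re_inner_le_of_eigenvalue_le {E : Type*} [NormedAddCommGroup E] [InnerProductSpace ℂ E]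
    [FiniteDimensional ℂ E] {T : E →ₗ[ℂ] E} (hT : T.IsSymmetric) {V : Submodule ℂ E}
    (hV : ∀ v ∈ V, T v ∈ V) {c : ℝ} (hc : ∀ (r : ℝ), ∀ v ∈ V, T v = (r : ℂ) • v → c < r → v = 0)
    {x : E} (hx : x ∈ V) : (inner ℂ x (T x)).re ≤ c * ‖x‖ ^ 2 := by
  have hS := hT.restrict_invariant hV
  set b := hS.eigenvectorBasis rfl with hb
  set y : V := ⟨x, hx⟩ with hy
  have hle : ∀ i, hS.eigenvalues rfl i ≤ c := by
    intro i
    by_contra h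
    have h1 := hS.apply_eigenvectorBasis rfl i
    have h2 := hc (hS.eigenvalues rfl i) (b i) (b i).2 (congrArg Subtype.val h1)
      (not_le.1 h)
    exact b.orthonormal.ne_zero i (Subtype.ext h2)
  have h1 : inner ℂ x (T x) = inner ℂ y (T.restrict hV y) := rfl
  have h2 : ‖x‖ ^ 2 = ∑ i, ‖inner ℂ (b i) y‖ ^ 2 := (b.sum_sq_norm_inner_right y).symm
  rw [h1, h2, ← b.sum_inner_mul_inner, Complex.re_sum, Finset.mul_sum]
  refine Finset.sum_le_sum fun i _ => ?_
  have h3 : inner ℂ (b i) (T.restrict hV y) = (hS.eigenvalues rfl i : ℂ) * inner ℂ (b i) y := by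
    rw [← hS (b i) y, hb, hS.apply_eigenvectorBasis, inner_smul_left]
    simp only [Complex.coe_algebraMap, Complex.conj_ofReal]
  rw [h3, ← inner_conj_symm y (b i)]
  have h4 : (starRingEnd ℂ) (inner ℂ (b i) y) * ((hS.eigenvalues rfl i : ℂ) * inner ℂ (b i) y) =
      ((hS.eigenvalues rfl i * ‖inner ℂ (b i) y‖ ^ 2 : ℝ) : ℂ) := by
    rw [mul_left_comm, mul_comm ((starRingEnd ℂ) _), Complex.mul_conj, Complex.normSq_eq_norm_sq]
    push_cast; ring
  rw [h4, Complex.ofReal_re]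
  gcongr
  exact hle i

/-- A bound for the overlap of the permutation spans of two subsets of `m - 1` among `m` places. -/
def overlapBound (m : ℕ) : ℝ :=
  (9 * (1 / 2) ^ (m - 2) + 6 * ((1 / 2) ^ (m - 2)) ^ 2) / (2 * (4 - ((1 / 2) ^ (m - 2)) ^ 2))

theorem half_pow_le_half {m : ℕ} (hm : 3 ≤ m) : (1 / 2 : ℝ) ^ (m - 2) ≤ 1 / 2 := by
  simpa using pow_le_pow_of_le_one (by norm_num : (0 : ℝ) ≤ 1 / 2) (by norm_num)
    (by omega : 1 ≤ m - 2)

theorem overlapBound_nonneg (m : ℕ) : 0 ≤ overlapBound m := by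
  have h : ((1 / 2 : ℝ) ^ (m - 2)) ^ 2 ≤ 1 := by
    rw [← pow_mul]; exact pow_le_one₀ (by norm_num) (by norm_num)
  unfold overlapBound
  have : 0 < 4 - ((1 / 2 : ℝ) ^ (m - 2)) ^ 2 := by linarith
  positivity

section PermSpan

variable {ι Q : Type*} [Fintype ι] [DecidableEq ι] [Fintype Q] [DecidableEq Q]
  {p : Equiv.Perm (Fin 3) → Q → ℂ}

theorem sum_gramInv_translate (y : ℝ) (h1 : 1 - y ^ 2 ≠ 0) (h2 : 1 - 4 * y ^ 2 ≠ 0)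
    (h : Equiv.Perm (Fin 3) → ℂ) (π : Equiv.Perm (Fin 3)) :
    ∑ τ, (∑ κ, h κ * gramInv y (κ⁻¹ * τ)) * (y ^ permLength (τ⁻¹ * π) : ℝ) = h π := by
  simp only [Finset.sum_mul]
  rw [Finset.sum_comm]
  have : ∀ κ, ∑ τ, h κ * gramInv y (κ⁻¹ * τ) * (y ^ permLength (τ⁻¹ * π) : ℝ) =
      h κ * if κ = π then 1 else 0 := by
    intro κ
    rw [← Equiv.sum_comp (Equiv.mulLeft κ)]
    simp only [Equiv.coe_mulLeft, inv_mul_cancel_left, mul_inv_rev, mul_assoc]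
    rw [← Finset.mul_sum]
    congr 1
    have := sum_gramInv y h1 h2 (κ⁻¹ * π)
    simp only [inv_mul_eq_one] at this
    simp only [← Complex.ofReal_mul, ← Complex.ofReal_sum, this]
    split_ifs <;> simp
  rw [Finset.sum_congr rfl fun κ _ => this κ]
  simp

theorem sum_gramCoeff_translate (x : ℝ) (hx : 4 - x ^ 2 ≠ 0) (ρ τ' π : Equiv.Perm (Fin 3))
    (h : τ' ≠ ρ) :
    ∑ τ, gramCoeff x (ρ⁻¹ * τ') (ρ⁻¹ * τ) * (x / 2) ^ permLength (τ⁻¹ * π) =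
      x ^ permLength (ρ⁻¹ * π) * (1 / 2) ^ permLength (τ'⁻¹ * π) := by
  rw [← Equiv.sum_comp (Equiv.mulLeft ρ)]
  simp only [Equiv.coe_mulLeft, inv_mul_cancel_left, mul_inv_rev, mul_assoc]
  rw [sum_gramCoeff x hx (ρ⁻¹ * τ') (ρ⁻¹ * π) (fun h' => h (inv_mul_eq_one.1 h').symm)]
  simp [mul_assoc]

/-- Pairings of `ψ` with the vectors `mixVec p A k (p τ) ρ w` satisfy a recursion of `ℓ¹` size
`(A.card - 1) * overlapBound A.card`, which is smaller than `r - 1`; so they vanish, and with them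
all pairings with the spans of the sets `A.erase k`. -/
theorem eq_zero_of_sum_starProjection_eq_smul
    (hG : ∀ σ τ, ∑ q, star (p σ q) * p τ q = ((1 / 2 : ℝ) ^ permLength (σ⁻¹ * τ) : ℝ))
    {A : Finset ι} (hA : 3 ≤ A.card) {ψ : EuclideanSpace ℂ (ι → Q)} (hψ : ψ ∈ (permSpan p A)ᗮ)
    {r : ℝ} (hr : 1 + (A.card - 1) * overlapBound A.card < r)
    (hT : ∑ k ∈ A, (permSpan p (A.erase k)).starProjection ψ = (r : ℂ) • ψ) : ψ = 0 := by
  have hA1 : (1 : ℝ) ≤ A.card := by exact_mod_cast (by omega : 1 ≤ A.card)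
  have hr1 : 1 < r := by nlinarith [overlapBound_nonneg A.card]
  have hr0 : (r : ℂ) - 1 ≠ 0 := by
    rw [← Complex.ofReal_one, ← Complex.ofReal_sub, Complex.ofReal_ne_zero]; linarith
  set x : ℝ := (1 / 2) ^ (A.card - 2) with hxdef
  have hx0 : 0 ≤ x := by positivity
  have hx : x ≤ 1 / 2 := half_pow_le_half hA
  have hx4 : 4 - x ^ 2 ≠ 0 := by nlinarith
  have hxy : (1 / 2 : ℝ) ^ (A.card - 1) = x / 2 := by
    rw [hxdef, show A.card - 1 = A.card - 2 + 1 by omega, pow_succ]; ring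
  have hproj : ∀ k, ∀ v ∈ permSpan p (A.erase k),
      inner ℂ v ((permSpan p (A.erase k)).starProjection ψ) = inner ℂ v ψ := by
    intro k v hv
    rw [← Submodule.inner_starProjection_left_eq_right,
      Submodule.starProjection_eq_self_iff.2 hv]
  -- Pairing the eigenvalue equation with a vector of `permSpan p (A.erase k)`: the `k`-th
  -- projection returns the pairing with `ψ` itself, whence `r - 1`, and the others are rewritten
  -- through test vectors for `A.erase l`.
  have hrec : ∀ k ∈ A, ∀ (u : Q → ℂ) ρ (w : ι → Q) (e : Equiv.Perm (Fin 3) → ℂ),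
      (∀ π, ∑ τ, e τ * (((1 / 2 : ℝ) ^ (A.card - 1)) ^ permLength (τ⁻¹ * π) : ℝ) =
        (((1 / 2 : ℝ) ^ (A.card - 2)) ^ permLength (ρ⁻¹ * π) : ℝ) * ∑ q, star (u q) * p π q) →
      ((r : ℂ) - 1) * inner ℂ (mixVec p A k u ρ w) ψ =
        ∑ l ∈ A.erase k, ∑ τ, e τ * inner ℂ (mixVec p A l (p ρ) τ w) ψ := by
    intro k hk u ρ w e he
    have h1 := congrArg (inner ℂ (mixVec p A k u ρ w)) hT
    rw [inner_sum, inner_smul_right, ← Finset.add_sum_erase _ _ hk,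
      hproj k _ (mixVec_mem p A k u ρ w)] at h1
    rw [sub_mul, one_mul, ← h1, add_sub_cancel_left]
    refine Finset.sum_congr rfl fun l hl => ?_
    rw [Finset.mem_erase] at hl
    rw [inner_mixVec_eq_sum hG hk hl.2 hl.1.symm u ρ w e he (Submodule.starProjection_apply_mem _ _)]
    exact Finset.sum_congr rfl fun τ _ => by rw [hproj l _ (mixVec_mem p A l _ τ w)]
  have hdiag : ∀ k ∈ A, ∀ ρ w, inner ℂ (mixVec p A k (p ρ) ρ w) ψ = 0 := by
    intro k hk ρ w
    rw [← permVec_eq_mixVec p hk]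
    exact (Submodule.mem_orthogonal _ _).1 hψ _ (permVec_mem p A ρ w)
  have hoff : ∀ k ∈ A, ∀ ρ τ w, inner ℂ (mixVec p A k (p τ) ρ w) ψ = 0 := by
    by_contra hne
    push Not at hne
    obtain ⟨k₀, hk₀, ρ₀, τ₀, w₀, hne⟩ := hne
    -- A pairing of largest modulus is compared with its own expansion.
    obtain ⟨⟨k, ρ, τ, w⟩, hmem, hmax⟩ := Finset.exists_max_image
      (A ×ˢ (Finset.univ : Finset (Equiv.Perm (Fin 3) × Equiv.Perm (Fin 3) × (ι → Q))))
      (fun a => ‖inner ℂ (mixVec p A a.1 (p a.2.2.1) a.2.1 a.2.2.2) ψ‖)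
      ⟨(k₀, ρ₀, τ₀, w₀), by simp [hk₀]⟩
    simp only [Finset.mem_product, Finset.mem_univ, and_true, Prod.forall] at hmem hmax
    set μ := ‖inner ℂ (mixVec p A k (p τ) ρ w) ψ‖ with hμ
    have hμ0 : 0 < μ := (norm_pos_iff.2 hne).trans_le (hmax k₀ ρ₀ τ₀ w₀ hk₀)
    have hτρ : τ ≠ ρ := by
      rintro rfl
      rw [hμ, hdiag k hmem, norm_zero] at hμ0
      exact lt_irrefl _ hμ0
    have h1 := hrec k hmem (p τ) ρ w (fun τ' => (gramCoeff x (ρ⁻¹ * τ) (ρ⁻¹ * τ') : ℝ)) (by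
      intro π
      rw [hG, hxy, ← Complex.ofReal_mul, ← sum_gramCoeff_translate x hx4 ρ τ π hτρ,
        Complex.ofReal_sum]
      simp only [Complex.ofReal_mul])
    have h2 : ∀ l ∈ A.erase k, ‖∑ τ', ((gramCoeff x (ρ⁻¹ * τ) (ρ⁻¹ * τ') : ℝ) : ℂ) *
        inner ℂ (mixVec p A l (p ρ) τ' w) ψ‖ ≤ overlapBound A.card * μ := by
      intro l hl
      have hlA := Finset.mem_of_mem_erase hl
      rw [← Finset.add_sum_erase _ _ (Finset.mem_univ ρ), hdiag l hlA, mul_zero, zero_add]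
      refine (norm_sum_le _ _).trans ?_
      have h3 : ∑ τ' ∈ Finset.univ.erase ρ, |gramCoeff x (ρ⁻¹ * τ) (ρ⁻¹ * τ')| =
          ∑ h ∈ Finset.univ.erase 1, |gramCoeff x (ρ⁻¹ * τ) h| :=
        Finset.sum_equiv (Equiv.mulLeft ρ⁻¹) (by simp [inv_mul_eq_one, eq_comm]) (by simp)
      refine le_trans ?_ (mul_le_mul_of_nonneg_right (h3.le.trans (sum_abs_gramCoeff_le x hx0 hx _
        fun h => hτρ (inv_mul_eq_one.1 h).symm)) hμ0.le)
      rw [Finset.sum_mul]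
      refine Finset.sum_le_sum fun τ' _ => ?_
      rw [norm_mul, Complex.norm_real, Real.norm_eq_abs]
      exact mul_le_mul_of_nonneg_left (hmax l τ' ρ w hlA) (abs_nonneg _)
    have h4 : (r - 1) * μ ≤ (A.card - 1) * (overlapBound A.card * μ) := by
      have h5 : ‖((r : ℂ) - 1) * inner ℂ (mixVec p A k (p τ) ρ w) ψ‖ = (r - 1) * μ := by
        rw [norm_mul, ← Complex.ofReal_one, ← Complex.ofReal_sub, Complex.norm_real,
          Real.norm_of_nonneg (by linarith)]
      rw [← h5, h1]
      refine (norm_sum_le_of_le _ h2).trans (le_of_eq ?_)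
      rw [Finset.sum_const, Finset.card_erase_of_mem hmem, nsmul_eq_mul,
        Nat.cast_sub (by omega), Nat.cast_one]
    nlinarith
  -- With a basis vector as the factor at `k`, `hrec` expresses the pairing with a spanning vector
  -- through pairings already known to vanish. Its coefficients exist because the Gram matrix is
  -- invertible, and their size is irrelevant.
  have hall : ∀ k ∈ A, (permSpan p (A.erase k)).starProjection ψ = 0 := by
    intro k hk
    rw [Submodule.starProjection_apply_eq_zero_iff]
    have hspan : permSpan p (A.erase k) ≤ (ℂ ∙ ψ)ᗮ := by
      refine Submodule.span_le.2 ?_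
      rintro _ ⟨⟨ρ, w⟩, rfl⟩
      have hw : permVec p (A.erase k) ρ w = mixVec p A k (Pi.single (w k) 1) ρ w := by
        rw [mixVec_eq_sum, Finset.sum_eq_single (w k)] <;> simp +contextual
      have hy1 : 1 - (x / 2) ^ 2 ≠ 0 := by nlinarith
      have hy2 : 1 - 4 * (x / 2) ^ 2 ≠ 0 := by nlinarith
      have h1 := hrec k hk (Pi.single (w k) 1) ρ w _ (by
        intro π
        rw [hxy]
        exact sum_gramInv_translate (x / 2) hy1 hy2 (fun π =>
          (((1 / 2 : ℝ) ^ (A.card - 2)) ^ permLength (ρ⁻¹ * π) : ℝ) *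
            ∑ q, star ((Pi.single (w k) 1 : Q → ℂ) q) * p π q) π)
      rw [Finset.sum_eq_zero (fun l hl => Finset.sum_eq_zero fun τ _ => by
        rw [hoff l (Finset.mem_of_mem_erase hl), mul_zero])] at h1
      rw [SetLike.mem_coe, Submodule.mem_orthogonal_singleton_iff_inner_left]
      simp only [hw]
      exact (mul_eq_zero.1 h1).resolve_left hr0
    rw [Submodule.mem_orthogonal]
    intro v hv
    exact Submodule.mem_orthogonal_singleton_iff_inner_left.1 (hspan hv)
  rw [Finset.sum_eq_zero hall] at hT
  exact (smul_eq_zero.1 hT.symm).resolve_left (Complex.ofReal_ne_zero.2 (by linarith))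

end PermSpan

/-! ### The spectral gap by induction on the number of places -/

theorem norm_sub_starProjection_sq {E : Type*} [NormedAddCommGroup E] [InnerProductSpace ℂ E]
    (K : Submodule ℂ E) [K.HasOrthogonalProjection] (x : E) :
    ‖x - K.starProjection x‖ ^ 2 = ‖x‖ ^ 2 - (inner ℂ x (K.starProjection x)).re := by
  have h1 := K.norm_sq_eq_add_norm_sq_starProjection x
  have h2 := K.re_inner_starProjection_eq_normSq x
  rw [Submodule.starProjection_orthogonal_val] at h1
  rw [← inner_conj_symm]
  simp only [RCLike.re_to_complex] at h2
  have h3 : ‖K.starProjection x‖ = ‖K.orthogonalProjectionOnto x‖ := rfl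
  rw [Complex.conj_re, h2, ← h3]
  linarith

section PermSpan

variable {ι Q : Type*} [Fintype ι] [DecidableEq ι] [Fintype Q] [DecidableEq Q]
  {p : Equiv.Perm (Fin 3) → Q → ℂ}

/-- All the spans of the sets `A.erase k` contain that of `A`, so `ψ` may be replaced by its
component `φ` orthogonal to the latter. The sum is then `A.card * ‖φ‖²` minus the Rayleigh form of
the sum of projections, which the eigenvalue bound controls. -/
theorem le_sum_norm_sub_starProjection_erase_sq
    (hG : ∀ σ τ, ∑ q, star (p σ q) * p τ q = ((1 / 2 : ℝ) ^ permLength (σ⁻¹ * τ) : ℝ))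
    {A : Finset ι} (hA : 3 ≤ A.card) (ψ : EuclideanSpace ℂ (ι → Q)) :
    (A.card - 1) * (1 - overlapBound A.card) * ‖ψ - (permSpan p A).starProjection ψ‖ ^ 2 ≤
      ∑ k ∈ A, ‖ψ - (permSpan p (A.erase k)).starProjection ψ‖ ^ 2 := by
  set φ := ψ - (permSpan p A).starProjection ψ with hφ
  have hφm : φ ∈ (permSpan p A)ᗮ := Submodule.sub_starProjection_mem_orthogonal ψ
  have hsub : ∀ k, ψ - (permSpan p (A.erase k)).starProjection ψ =
      φ - (permSpan p (A.erase k)).starProjection φ := by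
    intro k
    have h1 : (permSpan p (A.erase k)).starProjection ((permSpan p A).starProjection ψ) =
        (permSpan p A).starProjection ψ := Submodule.starProjection_eq_self_iff.2
      (permSpan_le_erase p A k (Submodule.starProjection_apply_mem _ _))
    rw [hφ, map_sub, h1]
    abel
  set T : EuclideanSpace ℂ (ι → Q) →ₗ[ℂ] EuclideanSpace ℂ (ι → Q) :=
    ∑ k ∈ A, ((permSpan p (A.erase k)).starProjection : _ →ₗ[ℂ] _) with hT
  have hTa : ∀ x, T x = ∑ k ∈ A, (permSpan p (A.erase k)).starProjection x := fun x => by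
    simp [hT]
  have hsym : T.IsSymmetric := by
    intro x y
    simp only [hTa, sum_inner, inner_sum]
    exact Finset.sum_congr rfl fun k _ => Submodule.inner_starProjection_left_eq_right _ _ _
  have hinv : ∀ v ∈ (permSpan p A)ᗮ, T v ∈ (permSpan p A)ᗮ := by
    intro v hv
    rw [Submodule.mem_orthogonal] at hv ⊢
    intro u hu
    rw [hTa, inner_sum]
    refine Finset.sum_eq_zero fun k _ => ?_
    rw [← Submodule.inner_starProjection_left_eq_right,
      Submodule.starProjection_eq_self_iff.2 (permSpan_le_erase p A k hu), hv u hu]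
  have hray := re_inner_le_of_eigenvalue_le hsym hinv
    (c := 1 + (A.card - 1) * overlapBound A.card) (fun r v hv hTv hr =>
      eq_zero_of_sum_starProjection_eq_smul hG hA hv hr (by rw [← hTa, hTv])) hφm
  rw [hTa, inner_sum, Complex.re_sum] at hray
  simp only [hsub, norm_sub_starProjection_sq, Finset.sum_sub_distrib, Finset.sum_const,
    nsmul_eq_mul]
  linarith

variable (p) in
/-- The sum of the squared distances to the permutation spans of the pairs in `A`. -/
def pairDefect (A : Finset ι) (ψ : EuclideanSpace ℂ (ι → Q)) : ℝ :=
  ∑ q ∈ A.offDiag, ‖ψ - (permSpan p {q.1, q.2}).starProjection ψ‖ ^ 2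

/-- Double counting: an ordered pair in `A` survives the removal of each of the other `A.card - 2`
elements. -/
theorem sum_pairDefect_erase (A : Finset ι) (ψ : EuclideanSpace ℂ (ι → Q)) :
    ∑ k ∈ A, pairDefect p (A.erase k) ψ = ((A.card - 2 : ℕ) : ℝ) * pairDefect p A ψ := by
  have h : ∀ k, (A.erase k).offDiag = A.offDiag.filter fun q => k ≠ q.1 ∧ k ≠ q.2 := by
    intro k
    ext q
    simp only [Finset.mem_offDiag, Finset.mem_erase, Finset.mem_filter, ne_eq, eq_comm]
    tauto
  simp only [pairDefect, h, Finset.sum_filter]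
  rw [Finset.sum_comm, Finset.mul_sum]
  refine Finset.sum_congr rfl fun q hq => ?_
  rw [Finset.mem_offDiag] at hq
  rw [← Finset.sum_filter, Finset.sum_const, nsmul_eq_mul]
  congr 2
  have : A.filter (fun k => k ≠ q.1 ∧ k ≠ q.2) = (A.erase q.1).erase q.2 := by
    ext k
    simp only [Finset.mem_erase, Finset.mem_filter]
    tauto
  rw [this, Finset.card_erase_of_mem (Finset.mem_erase.2 ⟨hq.2.2.symm, hq.2.1⟩),
    Finset.card_erase_of_mem hq.1]
  rfl

/-- Lower bounds for the gap in units of `1 / m ^ 2`. -/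
def gapFactor (m : ℕ) : ℝ := if m = 2 then 4 else if m = 3 then 6 / 5 else 1

theorem one_le_gapFactor (m : ℕ) : 1 ≤ gapFactor m := by
  unfold gapFactor; split_ifs <;> norm_num

theorem five_mul_le_two_pow {m : ℕ} (hm : 5 ≤ m) : 5 * m ≤ 2 ^ m := by
  induction m, hm using Nat.le_induction with
  | base => norm_num
  | succ m hm ih => rw [pow_succ]; omega

/-- This is the inequality that closes the induction. It is an equality at `m = 2`, where
`overlapBound 3 = 4/5`; the values 4 and 6/5 of `gapFactor` absorb the large overlaps at 3 and 4
places. From `m = 4` on, `overlapBound (m + 1) ≤ 1/(m + 1)` suffices. -/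
theorem gapFactor_step {m : ℕ} (hm : 2 ≤ m) :
    (m : ℝ) / (m + 1) * gapFactor (m + 1) ≤ gapFactor m * (1 - overlapBound (m + 1)) := by
  rcases Nat.lt_or_ge m 4 with h | h
  · interval_cases m <;> norm_num [gapFactor, overlapBound]
  · have h1 : gapFactor m = 1 := by unfold gapFactor; rw [if_neg (by omega), if_neg (by omega)]
    have h2 : gapFactor (m + 1) = 1 := by
      unfold gapFactor; rw [if_neg (by omega), if_neg (by omega)]
    rw [h1, h2, overlapBound, mul_one, one_mul]
    set x : ℝ := (1 / 2) ^ (m + 1 - 2) with hx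
    have hx0 : 0 < x := by positivity
    have h3 : (5 * (m + 1)) * x ≤ 4 := by
      have h4 : x * 2 ^ (m + 1) = 4 := by
        obtain ⟨j, rfl⟩ : ∃ j, m = j + 1 := ⟨m - 1, by omega⟩
        rw [hx, show j + 1 + 1 - 2 = j by omega, pow_succ (2 : ℝ), pow_succ (2 : ℝ)]
        rw [show (1 / 2 : ℝ) ^ j * (2 ^ j * 2 * 2) = (1 / 2 * 2) ^ j * 4 by
          rw [mul_pow]; ring]
        norm_num
      rw [← h4, mul_comm]
      gcongr
      exact_mod_cast five_mul_le_two_pow (by omega : 5 ≤ m + 1)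
    have hx1 : x ≤ 1 / 8 := by
      rw [hx, show (1 / 8 : ℝ) = (1 / 2) ^ 3 by norm_num]
      exact pow_le_pow_of_le_one (by norm_num) (by norm_num) (by omega)
    have h5 : (9 * x + 6 * x ^ 2) / (2 * (4 - x ^ 2)) ≤ 5 / 4 * x := by
      rw [div_le_iff₀ (by nlinarith)]
      nlinarith [mul_nonneg hx0.le (sub_nonneg.2 hx1), pow_pos hx0 2, pow_pos hx0 3]
    have h6 : (m : ℝ) / (m + 1) = 1 - 1 / (m + 1) := by field_simp; ring
    have h7 : 5 / 4 * x ≤ 1 / (m + 1) := by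
      rw [le_div_iff₀ (by positivity)]; nlinarith
    rw [h6]
    linarith

theorem le_pairDefect_of_card
    (hG : ∀ σ τ, ∑ q, star (p σ q) * p τ q = ((1 / 2 : ℝ) ^ permLength (σ⁻¹ * τ) : ℝ))
    (ψ : EuclideanSpace ℂ (ι → Q)) {m : ℕ} (hm : 2 ≤ m) (A : Finset ι) (hA : A.card = m) :
    (m - 1) / m * gapFactor m * ‖ψ - (permSpan p A).starProjection ψ‖ ^ 2 ≤ pairDefect p A ψ := by
  induction m, hm using Nat.le_induction generalizing A with
  | base =>
    obtain ⟨i, j, hij, rfl⟩ := Finset.card_eq_two.1 hA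
    have h : ({i, j} : Finset ι).offDiag = {(i, j), (j, i)} := by
      ext ⟨a, b⟩
      simp only [Finset.mem_offDiag, Finset.mem_insert, Finset.mem_singleton, Prod.mk.injEq]
      constructor
      · rintro ⟨rfl | rfl, rfl | rfl, h⟩ <;> simp_all
      · rintro (⟨rfl, rfl⟩ | ⟨rfl, rfl⟩) <;> simp [hij, hij.symm]
    -- Both orderings of the pair give the same distance, so the defect is twice its square: this is
    -- `(2 - 1)/2 * gapFactor 2 = 2`.
    rw [pairDefect, h, Finset.sum_pair (by simp [hij])]
    simp only [Finset.pair_comm j i]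
    norm_num [gapFactor]
    linarith
  | succ m hm ih =>
    have hm0 : (0 : ℝ) < m - 1 := by
      have : (2 : ℝ) ≤ m := by exact_mod_cast hm
      linarith
    have hA3 : 3 ≤ A.card := by omega
    have h1 := le_sum_norm_sub_starProjection_erase_sq hG hA3 ψ
    have h2 := sum_pairDefect_erase (p := p) A ψ
    rw [hA] at h1 h2
    rw [show ((m + 1 - 2 : ℕ) : ℝ) = m - 1 by
      rw [Nat.cast_sub (by omega)]; push_cast; ring] at h2
    have h3 : (m - 1) / m * gapFactor m * ∑ k ∈ A,
        ‖ψ - (permSpan p (A.erase k)).starProjection ψ‖ ^ 2 ≤ (m - 1) * pairDefect p A ψ := by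
      rw [← h2, Finset.mul_sum]
      refine Finset.sum_le_sum fun k hk => ih (A.erase k) ?_
      rw [Finset.card_erase_of_mem hk, hA]; rfl
    have hg : 0 ≤ (m - 1) / m * gapFactor m :=
      mul_nonneg (by positivity) (zero_le_one.trans (one_le_gapFactor m))
    have h4 := (mul_le_mul_of_nonneg_left h1 hg).trans h3
    have h5 := gapFactor_step hm
    have hm' : (m : ℝ) ≠ 0 := by linarith
    set D := ‖ψ - (permSpan p A).starProjection ψ‖ ^ 2
    have h6 : (m - 1) / m * gapFactor m * (((m + 1 : ℕ) - 1) * (1 - overlapBound (m + 1)) * D) =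
        (m - 1) * (gapFactor m * (1 - overlapBound (m + 1)) * D) := by
      push_cast; field_simp; ring
    rw [h6] at h4
    refine le_trans ?_ (le_of_mul_le_mul_left h4 hm0)
    push_cast
    rw [add_sub_cancel_right]
    exact mul_le_mul_of_nonneg_right h5 (sq_nonneg _)

/-- The spectral gap: the squared distance to the permutation span of all `n` places is bounded by
the sum of the squared distances to the permutation spans of the pairs. -/
theorem norm_sub_starProjection_sq_le_pairDefect
    (hG : ∀ σ τ, ∑ q, star (p σ q) * p τ q = ((1 / 2 : ℝ) ^ permLength (σ⁻¹ * τ) : ℝ))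
    (hn : 2 ≤ Fintype.card ι) (ψ : EuclideanSpace ℂ (ι → Q)) :
    (Fintype.card ι - 1) / Fintype.card ι *
      ‖ψ - (permSpan p (Finset.univ : Finset ι)).starProjection ψ‖ ^ 2 ≤
      pairDefect p Finset.univ ψ := by
  have hn' : (2 : ℝ) ≤ Fintype.card ι := by exact_mod_cast hn
  refine le_trans ?_ (le_pairDefect_of_card hG ψ hn Finset.univ Finset.card_univ)
  refine mul_le_mul_of_nonneg_right ?_ (sq_nonneg _)
  exact le_mul_of_one_le_right (div_nonneg (by linarith) (by linarith)) (one_le_gapFactor _)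

end PermSpan

/-! ### The commutant of the third tensor power of the unitary group -/

section Commutant

variable {κ : Type*} [Fintype κ] [DecidableEq κ]

theorem tensorPower_mul (t : ℕ) (A B : Matrix κ κ ℂ) :
    tensorPower t (A * B) = tensorPower t A * tensorPower t B := by
  ext x y
  simp only [tensorPower, Matrix.of_apply, Matrix.mul_apply, Finset.prod_univ_sum,
    Fintype.piFinset_univ, Finset.prod_mul_distrib]

theorem tensorPower_one (t : ℕ) : tensorPower t (1 : Matrix κ κ ℂ) = 1 := by
  ext x y
  simp only [tensorPower, Matrix.of_apply, Matrix.one_apply, Finset.prod_ite_zero,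
    Finset.prod_const_one, funext_iff, Finset.mem_univ, true_imp_iff]

theorem tensorPower_conjTranspose (t : ℕ) (A : Matrix κ κ ℂ) :
    tensorPower t Aᴴ = (tensorPower t A)ᴴ := by
  ext x y
  simp [tensorPower]

/-- The operator on `(ℂ^κ)^{⊗ 3}` permuting the tensor factors. -/
def tensorPerm (σ : Equiv.Perm (Fin 3)) : Matrix (Fin 3 → κ) (Fin 3 → κ) ℂ :=
  Matrix.of fun x y => if x = y ∘ σ then 1 else 0

theorem tensorPerm_commute (σ : Equiv.Perm (Fin 3)) (A : Matrix κ κ ℂ) :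
    Commute (tensorPerm σ) (tensorPower 3 A) := by
  ext x y
  have h1 : ∀ z : Fin 3 → κ, (x = z ∘ σ) ↔ z = x ∘ σ.symm := fun z => by
    rw [Equiv.eq_comp_symm, eq_comm]
  simp only [Matrix.mul_apply, tensorPerm, tensorPower, Matrix.of_apply, h1, ite_mul, one_mul,
    zero_mul, mul_ite, mul_one, mul_zero, Finset.sum_ite_eq', Finset.mem_univ, if_true]
  rw [← Equiv.prod_comp σ]
  simp

theorem one_add_smul_mem_unitaryGroup {P : Matrix κ κ ℂ} (hP : Pᴴ = P) (hPP : P * P = P) {z : ℂ}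
    (hz : ‖z‖ = 1) : 1 + (z - 1) • P ∈ Matrix.unitaryGroup κ ℂ := by
  rw [Matrix.mem_unitaryGroup_iff, Matrix.star_eq_conjTranspose]
  have h1 : z * star z = 1 := by
    rw [Complex.star_def, Complex.mul_conj, Complex.normSq_eq_norm_sq, hz]; norm_num
  rw [Matrix.conjTranspose_add, Matrix.conjTranspose_one, Matrix.conjTranspose_smul, hP, mul_add,
    add_mul, add_mul, smul_mul_smul_comm, hPP, mul_one, one_mul, mul_one, add_assoc, ← add_smul,
    ← add_smul, star_sub, star_one]
  rw [show star z - 1 + (z - 1) * (star z - 1) = z * star z - z by ring, h1]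
  simp

theorem infinite_setOf_norm_eq_one : {z : ℂ | ‖z‖ = 1}.Infinite := by
  have h : {z : ℂ | ‖z‖ = 1} = Metric.sphere 0 1 := by ext; simp
  rw [h]
  refine (isPreconnected_sphere (by simp) 0 1).infinite_of_nontrivial ⟨1, by simp, -1, by simp, ?_⟩
  norm_num

variable {B : Matrix (Fin 3 → κ) (Fin 3 → κ) ℂ}

theorem Commute.tensorPower_mul_right {A A' : Matrix κ κ ℂ} (h : Commute B (tensorPower 3 A))
    (h' : Commute B (tensorPower 3 A')) : Commute B (tensorPower 3 (A * A')) := by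
  rw [tensorPower_mul]; exact h.mul_right h'

-- Let `P` be the projection onto the line of `u`. For `|z| = 1` the matrix `1 + (z - 1) P` is
-- unitary. Commutation is polynomial in `z` and holds on the infinite unit circle, hence for every
-- complex `z`, including values where the matrix is singular.
open scoped ComplexOrder in
theorem commute_one_add_smul_vecMulVec
    (hB : ∀ V ∈ Matrix.unitaryGroup κ ℂ, Commute B (tensorPower 3 V)) (u : κ → ℂ) (w : ℂ) :
    Commute B (tensorPower 3 (1 + w • Matrix.vecMulVec u (star u))) := by
  by_cases hu : u = 0
  · subst hu
    simpa using hB 1 (one_mem _)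
  set c : ℂ := star u ⬝ᵥ u with hc
  have hc0 : c ≠ 0 := fun h => hu (dotProduct_star_self_eq_zero.1 h)
  have hcs : star c = c := (Matrix.star_dotProduct u u).symm
  set P : Matrix κ κ ℂ := c⁻¹ • Matrix.vecMulVec u (star u) with hP
  have hPh : Pᴴ = P := by
    rw [hP, Matrix.conjTranspose_smul, Matrix.conjTranspose_vecMulVec, star_star, star_inv₀, hcs]
  have hPP : P * P = P := by
    rw [hP, smul_mul_smul_comm, Matrix.vecMulVec_mul_vecMulVec, ← hc, Matrix.vecMulVec_smul,
      smul_smul]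
    congr 1
    field_simp
  let F : κ → κ → Polynomial ℂ := fun a b =>
    Polynomial.C ((1 : Matrix κ κ ℂ) a b) + (Polynomial.X - 1) * Polynomial.C (P a b)
  have hF : ∀ z a b, (F a b).eval z = (1 + (z - 1) • P : Matrix κ κ ℂ) a b := by
    intro z a b; simp [F]
  ext x y
  let f : Polynomial ℂ := ∑ v, Polynomial.C (B x v) * ∏ s, F (v s) (y s) -
    ∑ v, (∏ s, F (x s) (v s)) * Polynomial.C (B v y)
  have hf : ∀ z, f.eval z = (B * tensorPower 3 (1 + (z - 1) • P) : Matrix _ _ ℂ) x y -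
      (tensorPower 3 (1 + (z - 1) • P) * B : Matrix _ _ ℂ) x y := by
    intro z
    simp only [f, Polynomial.eval_sub, Polynomial.eval_finsetSum, Polynomial.eval_mul,
      Polynomial.eval_prod, hF, Polynomial.eval_C, Matrix.mul_apply, tensorPower, Matrix.of_apply]
  have hf0 : f = 0 := by
    refine f.eq_zero_of_infinite_isRoot (infinite_setOf_norm_eq_one.mono fun z hz => ?_)
    rw [Set.mem_ofPred_eq, Polynomial.IsRoot, hf, sub_eq_zero,
      (hB _ (one_add_smul_mem_unitaryGroup hPh hPP hz)).eq]
  -- This value of `z` makes `(z - 1) P` equal to `w u u†`.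
  have h1 := hf (1 + w * c)
  rw [hf0, Polynomial.eval_zero, hP, add_sub_cancel_left, smul_smul, mul_assoc,
    mul_inv_cancel₀ hc0, mul_one] at h1
  exact (sub_eq_zero.1 h1.symm)

/-- The matrix of the linear map sending the basis vector at `a` to the one at `f a`. -/
def mapMatrix (f : κ → κ) : Matrix κ κ ℂ := Matrix.of fun x y => if x = f y then 1 else 0

/-- Commuting with the matrix of `f` makes the column at `f ∘ y` the image of the column at `y`. -/
theorem apply_comp_eq_zero {f : κ → κ} (hB : Commute B (tensorPower 3 (mapMatrix f)))
    {y : Fin 3 → κ} (hy : ∀ x, B x y = 0) (x : Fin 3 → κ) : B x (f ∘ y) = 0 := by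
  have h := congrFun (congrFun hB.eq x) y
  have hm : ∀ a b : Fin 3 → κ, tensorPower 3 (mapMatrix f) a b = if a = f ∘ b then 1 else 0 := by
    intro a b
    simp only [tensorPower, mapMatrix, Matrix.of_apply, Finset.prod_ite_zero,
      Finset.prod_const_one, funext_iff, Finset.mem_univ, true_imp_iff, Function.comp_apply]
  simpa only [Matrix.mul_apply, hm, hy, mul_zero, Finset.sum_const_zero, mul_ite, mul_one,
    Finset.sum_ite_eq', Finset.mem_univ, if_true] using h

theorem commute_diagonal_ite
    (hB : ∀ V ∈ Matrix.unitaryGroup κ ℂ, Commute B (tensorPower 3 V)) (a : κ) (w : ℂ) :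
    Commute B (tensorPower 3 (Matrix.diagonal fun x => if x = a then w else 1)) := by
  convert commute_one_add_smul_vecMulVec hB (Pi.single a 1) (w - 1) using 2
  ext x y
  by_cases hxy : x = y
  · subst hxy
    by_cases hxa : x = a
    · subst hxa; simp [Matrix.vecMulVec_apply]
    · simp [Matrix.vecMulVec_apply, hxa]
  · by_cases hxa : x = a
    · subst hxa; simp [Matrix.vecMulVec_apply, hxy, Ne.symm hxy]
    · simp [Matrix.vecMulVec_apply, hxa, hxy]

theorem commute_mapMatrix_update
    (hB : ∀ V ∈ Matrix.unitaryGroup κ ℂ, Commute B (tensorPower 3 V)) {a b : κ} (hab : a ≠ b) :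
    Commute B (tensorPower 3 (mapMatrix (Function.update id a b))) := by
  -- The rank-one perturbation averages the coordinates `a` and `b`; deleting row `a` and doubling
  -- row `b` leaves the map sending both basis vectors to that of `b`.
  have h := Commute.tensorPower_mul_right (commute_diagonal_ite hB b 2)
    (Commute.tensorPower_mul_right (commute_diagonal_ite hB a 0)
    (commute_one_add_smul_vecMulVec hB (Pi.single a 1 - Pi.single b 1) (-(1 / 2))))
  convert h using 2
  ext x y
  simp only [Matrix.diagonal_mul, mapMatrix, Matrix.of_apply, Matrix.add_apply, Matrix.smul_apply,
    Matrix.vecMulVec_apply, Function.update_apply, id, Matrix.one_apply, Pi.sub_apply,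
    Pi.star_apply, Pi.single_apply, smul_eq_mul, star_sub]
  have hba := hab.symm
  by_cases hxa : x = a
  · subst hxa
    by_cases hy : y = x
    · subst hy; simp [hab]
    · simp [hy, Ne.symm hy]
  · by_cases hxb : x = b
    · subst hxb
      by_cases hya : y = a
      · subst hya; simp [hab, hba]
      · by_cases hyb : y = x
        · subst hyb; simp [hba]; norm_num
        · simp [hya, hyb, Ne.symm hyb]
    · by_cases hya : y = a
      · subst hya; simp [hxa, hxb]
      · simp [hxa, hxb, hya]

theorem commute_mapMatrix_perm
    (hB : ∀ V ∈ Matrix.unitaryGroup κ ℂ, Commute B (tensorPower 3 V)) (π : Equiv.Perm κ) :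
    Commute B (tensorPower 3 (mapMatrix π)) := by
  refine hB _ ?_
  rw [Matrix.mem_unitaryGroup_iff, Matrix.star_eq_conjTranspose]
  ext x y
  have h1 : ∀ x z, (x = π z) ↔ z = π.symm x := fun x z => by
    rw [Equiv.eq_symm_apply, eq_comm]
  simp [Matrix.mul_apply, mapMatrix, Matrix.one_apply, h1, eq_comm]

/-- The diagonal matrix that kills only the label `y s` annihilates the basis vector at `y` and
fixes the one at `x`. -/
theorem apply_eq_zero_of_missing
    (hB : ∀ V ∈ Matrix.unitaryGroup κ ℂ, Commute B (tensorPower 3 V)) {x y : Fin 3 → κ} (s : Fin 3)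
    (hx : ∀ r, x r ≠ y s) : B x y = 0 := by
  have h := congrFun (congrFun (commute_diagonal_ite hB (y s) 0).eq x) y
  have hm : ∀ v v' : Fin 3 → κ, tensorPower 3 (Matrix.diagonal fun a => if a = y s then 0 else 1)
      v v' = if v = v' then ∏ r, (if v r = y s then (0 : ℂ) else 1) else 0 := by
    intro v v'
    simp only [tensorPower, Matrix.of_apply, Matrix.diagonal_apply, Finset.prod_ite_zero,
      funext_iff, Finset.mem_univ, true_imp_iff]
  have hy : ∏ r, (if y r = y s then (0 : ℂ) else 1) = 0 :=
    Finset.prod_eq_zero (Finset.mem_univ s) (if_pos rfl)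
  have hx1 : ∏ r, (if x r = y s then (0 : ℂ) else 1) = 1 :=
    Finset.prod_eq_one fun r _ => if_neg (hx r)
  simp only [Matrix.mul_apply, hm, mul_ite, ite_mul, mul_zero, zero_mul, Finset.sum_ite_eq,
    Finset.sum_ite_eq', Finset.mem_univ, if_true, hy, hx1, one_mul] at h
  exact h.symm

/-- An injective `y` is a relabelling of `w`. Otherwise some label repeats and another is unused;
putting the unused label at one of the repetitions gives a column with more distinct labels, from
which `y` is recovered by collapsing one label onto another. -/
theorem apply_eq_zero_of_column
    (hB : ∀ V ∈ Matrix.unitaryGroup κ ℂ, Commute B (tensorPower 3 V)) (hκ : 3 ≤ Fintype.card κ)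
    {w : Fin 3 → κ} (hw : Function.Injective w) (h0 : ∀ x, B x w = 0) (y : Fin 3 → κ) :
    ∀ x, B x y = 0 := by
  induction hj : 3 - (Finset.univ.image y).card using Nat.strong_induction_on generalizing y with
  | _ j ih =>
  by_cases hy : Function.Injective y
  · obtain ⟨π, hπ⟩ : ∃ π : Equiv.Perm κ, π ∘ w = y := by
      have := Equiv.Perm.isMultiplyPretransitive κ 3
      obtain ⟨g, hg⟩ := MulAction.exists_smul_eq (Equiv.Perm κ) (⟨w, hw⟩ : Fin 3 ↪ κ) ⟨y, hy⟩
      exact ⟨g, congrArg (fun e : Fin 3 ↪ κ => (e : Fin 3 → κ)) hg⟩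
    rw [← hπ]
    exact apply_comp_eq_zero (commute_mapMatrix_perm hB π) h0
  · obtain ⟨s, s', hss, hne⟩ : ∃ s s', y s = y s' ∧ s ≠ s' := by
      simpa [Function.Injective] using hy
    have hlt : (Finset.univ.image y).card < 3 := by
      refine lt_of_le_of_ne (Finset.card_image_le.trans (by simp)) fun h => hy ?_
      exact fun a b => Finset.card_image_iff.1 (h.trans (by simp)) (by simp) (by simp)
    obtain ⟨z, hz⟩ : ∃ z, z ∉ Finset.univ.image y := by
      by_contra! h
      have := Finset.card_le_card (fun a _ => h a : Finset.univ ⊆ Finset.univ.image y)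
      rw [Finset.card_univ] at this
      omega
    have hzy : ∀ r, y r ≠ z := fun r hr => hz (Finset.mem_image.2 ⟨r, Finset.mem_univ _, hr⟩)
    have hcard : (Finset.univ.image (Function.update y s z)).card =
        (Finset.univ.image y).card + 1 := by
      rw [← Finset.card_insert_of_notMem hz]
      congr 1
      ext a
      simp only [Finset.mem_image, Finset.mem_univ, true_and, Finset.mem_insert]
      constructor
      · rintro ⟨r, rfl⟩
        by_cases hr : r = s
        · subst hr; simp
        · right; exact ⟨r, by simp [hr]⟩
      · rintro (rfl | ⟨r, rfl⟩)
        · exact ⟨s, by simp⟩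
        · by_cases hr : r = s
          · subst hr; exact ⟨s', by simp [hne.symm, hss]⟩
          · exact ⟨r, by simp [hr]⟩
    have hy' : y = Function.update id z (y s) ∘ Function.update y s z := by
      funext r
      by_cases hr : r = s
      · subst hr; simp
      · simp [hr, hzy r]
    rw [hy']
    exact apply_comp_eq_zero (commute_mapMatrix_update hB (hzy s).symm)
      (ih _ (by omega) _ rfl)

/-- Schur–Weyl duality for three tensor factors. -/
theorem exists_eq_sum_tensorPerm
    (hB : ∀ V ∈ Matrix.unitaryGroup κ ℂ, Commute B (tensorPower 3 V)) (hκ : 3 ≤ Fintype.card κ) :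
    ∃ f : Equiv.Perm (Fin 3) → ℂ, B = ∑ σ, f σ • tensorPerm σ := by
  obtain ⟨⟨w, hw⟩⟩ : Nonempty (Fin 3 ↪ κ) :=
    Function.Embedding.nonempty_of_card_le (by simpa using hκ)
  -- The column at the injective `w` determines an operator in the commutant, and its entries vanish
  -- except at rearrangements of `w`; they are the coefficients.
  refine ⟨fun σ => B (w ∘ σ) w, ?_⟩
  rw [← sub_eq_zero]
  ext x y
  refine apply_eq_zero_of_column (fun V hV => (hB V hV).sub_left
    (Commute.sum_left _ _ _ fun σ _ => (tensorPerm_commute σ V).smul_left _)) hκ hw ?_ y x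
  intro x
  rw [Matrix.sub_apply, Matrix.sum_apply]
  simp only [Matrix.smul_apply, tensorPerm, Matrix.of_apply, smul_eq_mul, mul_ite, mul_one,
    mul_zero]
  by_cases hx : ∃ σ : Equiv.Perm (Fin 3), x = w ∘ σ
  · obtain ⟨σ, rfl⟩ := hx
    have h1 : ∀ τ : Equiv.Perm (Fin 3), (w ∘ σ = w ∘ τ) ↔ τ = σ := by
      intro τ
      refine ⟨fun h => ?_, fun h => h ▸ rfl⟩
      ext r
      rw [hw (congrFun h r)]
    simp [h1]
  · rw [Finset.sum_eq_zero (fun σ _ => if_neg fun h => hx ⟨σ, h⟩), sub_zero]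
    by_contra hne
    refine hx ?_
    have h2 : ∀ s, ∃ r, x r = w s := by
      intro s
      by_contra! h
      exact hne (apply_eq_zero_of_missing hB s h)
    choose g hg using h2
    have hgi : Function.Injective g := fun a b hab => hw (by rw [← hg, ← hg, hab])
    refine ⟨(Equiv.ofBijective g (Finite.injective_iff_bijective.1 hgi)).symm, ?_⟩
    funext r
    obtain ⟨s, rfl⟩ := (Finite.injective_iff_surjective.1 hgi) r
    rw [hg, Function.comp_apply, Equiv.ofBijective_symm_apply_apply]

end Commutant

/-! ### Operators on three copies of `n` qubits, sorted by qubits -/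

/-- Labels of the matrix units on the three copies of one qubit. -/
abbrev QubitLabel : Type := (Fin 3 → Fin 2) × (Fin 3 → Fin 2)

/-- The normalised operator permuting the three copies of one qubit. -/
def qubitPerm (σ : Equiv.Perm (Fin 3)) (q : QubitLabel) : ℂ :=
  if q.1 = q.2 ∘ σ then ((√8)⁻¹ : ℝ) else 0

/-- The solutions `b` are the functions constant on the cycles of a permutation conjugate to `σ⁻¹ *
τ`, and the number of cycles is 3 minus the length. -/
theorem card_comp_perm_eq (σ τ : Equiv.Perm (Fin 3)) :
    (Finset.univ.filter fun b : Fin 3 → Fin 2 => b ∘ σ = b ∘ τ).card * 2 ^ permLength (σ⁻¹ * τ) =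
      8 := by
  revert σ τ
  decide +kernel

theorem sum_qubitPerm (σ τ : Equiv.Perm (Fin 3)) :
    ∑ q, star (qubitPerm σ q) * qubitPerm τ q =
      ((1 / 2 : ℝ) ^ permLength (σ⁻¹ * τ) : ℝ) := by
  have h8 : ((√8)⁻¹ : ℝ) * (√8)⁻¹ = 1 / 8 := by
    rw [← mul_inv, Real.mul_self_sqrt (by norm_num)]; norm_num
  have h1 : ∀ b : Fin 3 → Fin 2, ∑ a, star (qubitPerm σ (a, b)) * qubitPerm τ (a, b) =
      if b ∘ σ = b ∘ τ then ((1 / 8 : ℝ) : ℂ) else 0 := by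
    intro b
    rw [Finset.sum_eq_single (b ∘ σ)]
    · simp only [qubitPerm, if_true]
      split_ifs
      · rw [Complex.star_def, Complex.conj_ofReal, ← Complex.ofReal_mul, h8]
      · simp
    · intro a _ ha; simp [qubitPerm, ha]
    · simp
  rw [Fintype.sum_prod_type_right, Finset.sum_congr rfl fun b _ => h1 b, ← Finset.sum_filter,
    Finset.sum_const, nsmul_eq_mul, ← Complex.ofReal_natCast, ← Complex.ofReal_mul]
  congr 1
  have h2 : ((Finset.univ.filter fun b : Fin 3 → Fin 2 => b ∘ σ = b ∘ τ).card : ℝ) *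
      2 ^ permLength (σ⁻¹ * τ) = 8 := by exact_mod_cast card_comp_perm_eq σ τ
  rw [one_div_pow, eq_div_iff (by positivity)]
  linear_combination h2 / 8

variable {n : ℕ}

/-- The Hilbert space of operators on three copies of `n` qubits, sorted by qubits. -/
abbrev QubitSpace (n : ℕ) : Type := EuclideanSpace ℂ (Fin n → QubitLabel)

/-- Sorting the entries of an operator by qubits. -/
def vecEquiv : Matrix (Fin 3 → Bits n) (Fin 3 → Bits n) ℂ ≃ₗ[ℂ] QubitSpace n where
  toFun X := WithLp.toLp 2 fun z => X (fun s i => (z i).1 s) (fun s i => (z i).2 s)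
  invFun ψ := Matrix.of fun x y => ψ fun i => (fun s => x s i, fun s => y s i)
  map_add' X Y := by ext; simp
  map_smul' c X := by ext; simp
  left_inv X := by ext; simp
  right_inv ψ := by ext; simp

theorem vecEquiv_apply (X : Matrix (Fin 3 → Bits n) (Fin 3 → Bits n) ℂ) (z : Fin n → QubitLabel) :
    vecEquiv X z = X (fun s i => (z i).1 s) (fun s i => (z i).2 s) := rfl

theorem vecEquiv_symm_apply (ψ : QubitSpace n) (x y : Fin 3 → Bits n) :
    vecEquiv.symm ψ x y = ψ fun i => (fun s => x s i, fun s => y s i) := rfl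

/-- Sorting the labels of matrix entries by qubits. -/
def labelEquiv : (Fin n → QubitLabel) ≃ (Fin 3 → Bits n) × (Fin 3 → Bits n) where
  toFun z := (fun s i => (z i).1 s, fun s i => (z i).2 s)
  invFun p := fun i => (fun s => p.1 s i, fun s => p.2 s i)
  left_inv _ := rfl
  right_inv _ := rfl

theorem inner_vecEquiv (X Y : Matrix (Fin 3 → Bits n) (Fin 3 → Bits n) ℂ) :
    inner ℂ (vecEquiv X) (vecEquiv Y) = (Xᴴ * Y).trace := by
  simp only [PiLp.inner_apply, Matrix.trace, Matrix.diag, Matrix.mul_apply,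
    Matrix.conjTranspose_apply, vecEquiv_apply]
  rw [Finset.sum_comm, ← Fintype.sum_prod_type' fun x y => star (X x y) * Y x y,
    ← Equiv.sum_comp labelEquiv]
  refine Finset.sum_congr rfl fun z _ => ?_
  rw [RCLike.inner_apply, mul_comm]
  rfl

theorem norm_vecEquiv (X : Matrix (Fin 3 → Bits n) (Fin 3 → Bits n) ℂ) :
    ‖vecEquiv X‖ = schattenTwo X := by
  rw [schattenTwo, ← inner_vecEquiv, @norm_eq_sqrt_re_inner ℂ]
  rfl

/-! ### Operators invariant under two-qubit gates -/

/-- Replacing the bits at `i` and `j` in three basis labels. -/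
def setBits (i j : Fin n) (x : Fin 3 → Bits n) (a : Fin 3 → Fin 2 × Fin 2) : Fin 3 → Bits n :=
  fun s => Function.update (Function.update (x s) i (a s).1) j (a s).2

theorem setBits_left {i j : Fin n} (h : i ≠ j) (x : Fin 3 → Bits n) (a : Fin 3 → Fin 2 × Fin 2)
    (s : Fin 3) : setBits i j x a s i = (a s).1 := by simp [setBits, h]

theorem setBits_right (i j : Fin n) (x : Fin 3 → Bits n) (a : Fin 3 → Fin 2 × Fin 2)
    (s : Fin 3) : setBits i j x a s j = (a s).2 := by simp [setBits]

theorem setBits_other {i j k : Fin n} (hi : k ≠ i) (hj : k ≠ j) (x : Fin 3 → Bits n)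
    (a : Fin 3 → Fin 2 × Fin 2) (s : Fin 3) : setBits i j x a s k = x s k := by
  simp [setBits, hi, hj]

theorem setBits_injective {i j : Fin n} (h : i ≠ j) (x : Fin 3 → Bits n) :
    Function.Injective (setBits i j x) := by
  intro a b hab
  funext s
  refine Prod.ext ?_ ?_
  · rw [← setBits_left h x a, hab, setBits_left h]
  · rw [← setBits_right i j x a, hab, setBits_right]

theorem eq_setBits {i j : Fin n} {x v : Fin 3 → Bits n}
    (h : ∀ s k, k ≠ i → k ≠ j → v s k = x s k) : v = setBits i j x fun s => (v s i, v s j) := by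
  funext s k
  by_cases hj : k = j
  · subst hj; rw [setBits_right]
  · by_cases hi : k = i
    · subst hi; rw [setBits_left hj]
    · rw [setBits_other hi hj, h s k hi hj]

theorem tensorPower_onPair_setBits {i j : Fin n} (h : i ≠ j)
    (A : Matrix (Fin 2 × Fin 2) (Fin 2 × Fin 2) ℂ) (x : Fin 3 → Bits n)
    (a b : Fin 3 → Fin 2 × Fin 2) :
    tensorPower 3 (onPair i j A) (setBits i j x a) (setBits i j x b) = tensorPower 3 A a b := by
  simp only [tensorPower, Matrix.of_apply]
  refine Finset.prod_congr rfl fun s _ => ?_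
  simp only [onPair, Matrix.of_apply]
  rw [if_pos fun k hi hj => by rw [setBits_other hi hj, setBits_other hi hj], setBits_left h,
    setBits_left h, setBits_right, setBits_right]

theorem tensorPower_onPair_eq_zero {i j : Fin n} (A : Matrix (Fin 2 × Fin 2) (Fin 2 × Fin 2) ℂ)
    {x v : Fin 3 → Bits n} (h : ¬ ∀ s k, k ≠ i → k ≠ j → x s k = v s k) :
    tensorPower 3 (onPair i j A) x v = 0 := by
  simp only [not_forall] at h
  obtain ⟨s, k, hi, hj, hk⟩ := h
  rw [tensorPower, Matrix.of_apply]
  refine Finset.prod_eq_zero (Finset.mem_univ s) ?_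
  simp only [onPair, Matrix.of_apply]
  exact if_neg fun H => hk (H k hi hj)

/-- The block of an operator at given bits outside `i` and `j`. -/
def pairBlock (i j : Fin n) (X : Matrix (Fin 3 → Bits n) (Fin 3 → Bits n) ℂ)
    (x y : Fin 3 → Bits n) : Matrix (Fin 3 → Fin 2 × Fin 2) (Fin 3 → Fin 2 × Fin 2) ℂ :=
  Matrix.of fun a b => X (setBits i j x a) (setBits i j y b)

theorem commute_pairBlock {i j : Fin n} (h : i ≠ j)
    {X : Matrix (Fin 3 → Bits n) (Fin 3 → Bits n) ℂ}
    {A : Matrix (Fin 2 × Fin 2) (Fin 2 × Fin 2) ℂ}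
    (hX : Commute X (tensorPower 3 (onPair i j A))) (x y : Fin 3 → Bits n) :
    Commute (pairBlock i j X x y) (tensorPower 3 A) := by
  ext a b
  have h1 := congrFun (congrFun hX.eq (setBits i j x a)) (setBits i j y b)
  rw [Matrix.mul_apply, Matrix.mul_apply] at h1
  rw [Matrix.mul_apply, Matrix.mul_apply]
  refine (Fintype.sum_of_injective _ (setBits_injective h y) _ _ ?_ ?_).trans
    (h1.trans (Fintype.sum_of_injective _ (setBits_injective h x) _ _ ?_ ?_).symm)
  · intro v hv
    rw [tensorPower_onPair_eq_zero, mul_zero]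
    intro H
    exact hv ⟨_, (eq_setBits fun s k hi hj => by
      rw [H s k hi hj, setBits_other hi hj]).symm⟩
  · intro c
    rw [tensorPower_onPair_setBits h]; rfl
  · intro v hv
    rw [tensorPower_onPair_eq_zero, zero_mul]
    intro H
    exact hv ⟨_, (eq_setBits fun s k hi hj => by
      rw [← H s k hi hj, setBits_other hi hj]).symm⟩
  · intro c
    rw [tensorPower_onPair_setBits h]; rfl

/-- With the bits outside `i, j` frozen, each block commutes with `V^{⊗ 3}` for all `V ∈ 𝕌(4)`.
Schur–Weyl duality applies to it, since `4 ≥ 3`. -/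
theorem mem_permSpan_pair {i j : Fin n} (hij : i ≠ j) {ψ : QubitSpace n}
    (hψ : ∀ V ∈ Matrix.unitaryGroup (Fin 2 × Fin 2) ℂ,
      Commute (vecEquiv.symm ψ) (tensorPower 3 (onPair i j V))) :
    ψ ∈ permSpan qubitPerm {i, j} := by
  set X := vecEquiv.symm ψ with hX
  have h1 : ∀ w : Fin n → QubitLabel, ∃ f : Equiv.Perm (Fin 3) → ℂ,
      pairBlock i j X (labelEquiv w).1 (labelEquiv w).2 = ∑ σ, f σ • tensorPerm σ := fun w =>
    exists_eq_sum_tensorPerm (fun V hV => commute_pairBlock hij (hψ V hV) _ _) (by simp)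
  choose f hf using h1
  -- Requiring `w` to be `(0, 0)` at `i` and `j` counts each outside label once; the factor 8 undoes
  -- the two normalisations `1/√8`.
  have hsum : ψ = ∑ w : Fin n → QubitLabel, ∑ σ,
      (if w i = (0, 0) ∧ w j = (0, 0) then 8 * f w σ else 0) • permVec qubitPerm {i, j} σ w := by
    ext z
    set c : Fin n → QubitLabel := Function.update (Function.update z i (0, 0)) j (0, 0) with hc
    have hperm : ∀ (w : Fin n → QubitLabel) σ, permVec qubitPerm {i, j} σ w z =
        qubitPerm σ (z i) * qubitPerm σ (z j) *
          ∏ k ∈ ({i, j} : Finset (Fin n))ᶜ, if z k = w k then 1 else 0 := by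
      intro w σ
      simp only [permVec, prodVec]
      rw [← Finset.prod_mul_prod_compl {i, j}, Finset.prod_pair hij]
      congr 1
      · simp
      · refine Finset.prod_congr rfl fun k hk => ?_
        rw [if_neg (Finset.mem_compl.1 hk), Pi.single_apply]
    simp only [WithLp.ofLp_sum, Finset.sum_apply, WithLp.ofLp_smul, Pi.smul_apply, smul_eq_mul,
      hperm]
    rw [Finset.sum_eq_single c]
    · have hprod : ∏ k ∈ ({i, j} : Finset (Fin n))ᶜ, (if z k = c k then (1 : ℂ) else 0) = 1 := by
        refine Finset.prod_eq_one fun k hk => if_pos ?_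
        simp only [Finset.mem_compl, Finset.mem_insert, Finset.mem_singleton, not_or] at hk
        simp [hc, hk.1, hk.2]
      have hblock := congrFun (congrFun (hf c) fun s => ((z i).1 s, (z j).1 s))
        fun s => ((z i).2 s, (z j).2 s)
      have hz1 : setBits i j (labelEquiv c).1 (fun s => ((z i).1 s, (z j).1 s)) =
          (labelEquiv z).1 :=
        (eq_setBits (v := (labelEquiv z).1) fun s k hi hj => by
          simp [labelEquiv, hc, hi, hj]).symm
      have hz2 : setBits i j (labelEquiv c).2 (fun s => ((z i).2 s, (z j).2 s)) =
          (labelEquiv z).2 :=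
        (eq_setBits (v := (labelEquiv z).2) fun s k hi hj => by
          simp [labelEquiv, hc, hi, hj]).symm
      rw [pairBlock, Matrix.of_apply, hz1, hz2, Matrix.sum_apply] at hblock
      have hψz : ψ z = X (labelEquiv z).1 (labelEquiv z).2 := rfl
      rw [hψz, hblock]
      refine Finset.sum_congr rfl fun σ _ => ?_
      have hcij : c i = (0, 0) ∧ c j = (0, 0) := by simp [hc, hij]
      rw [if_pos hcij, hprod, mul_one, Matrix.smul_apply, smul_eq_mul]
      have h8 : (((√8)⁻¹ : ℝ) : ℂ) * ((√8)⁻¹ : ℝ) = 1 / 8 := by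
        rw [← Complex.ofReal_mul, ← mul_inv, Real.mul_self_sqrt (by norm_num)]; norm_num
      have hiff : ((fun s => ((z i).1 s, (z j).1 s)) = (fun s => ((z i).2 s, (z j).2 s)) ∘ σ) ↔
          (z i).1 = (z i).2 ∘ σ ∧ (z j).1 = (z j).2 ∘ σ := by
        simp only [funext_iff, Function.comp_apply, Prod.mk.injEq, forall_and]
      simp only [tensorPerm, Matrix.of_apply, qubitPerm, hiff]
      by_cases ha : (z i).1 = (z i).2 ∘ σ <;> by_cases hb : (z j).1 = (z j).2 ∘ σ <;>
        simp only [ha, hb, if_true, if_false, and_self, and_true, and_false, h8, mul_zero,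
          zero_mul] <;> ring
    · intro w _ hw
      refine Finset.sum_eq_zero fun σ _ => ?_
      by_cases hwij : w i = (0, 0) ∧ w j = (0, 0)
      · obtain ⟨k, hk⟩ := Function.ne_iff.1 hw
        have hki : k ≠ i := by rintro rfl; exact hk (by simp [hc, hij, hwij.1])
        have hkj : k ≠ j := by rintro rfl; exact hk (by simp [hc, hwij.2])
        have hck : c k = z k := by simp [hc, hki, hkj]
        rw [Finset.prod_eq_zero (i := k) (by simp [hki, hkj])
          (if_neg fun h => hk (by rw [hck, h])), mul_zero, mul_zero]
      · rw [if_neg hwij, zero_mul]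
    · simp
  rw [hsum]
  exact Submodule.sum_mem _ fun w _ => Submodule.sum_mem _ fun σ _ =>
    Submodule.smul_mem _ _ (permVec_mem _ _ _ _)

theorem commute_of_mem_permSpan_univ {ψ : QubitSpace n}
    (hψ : ψ ∈ permSpan qubitPerm (Finset.univ : Finset (Fin n)))
    (A : Matrix (Bits n) (Bits n) ℂ) : Commute (vecEquiv.symm ψ) (tensorPower 3 A) := by
  induction hψ using Submodule.span_induction with
  | mem ψ h =>
    obtain ⟨⟨σ, w⟩, rfl⟩ := h
    have h1 : vecEquiv.symm (permVec qubitPerm Finset.univ σ w) =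
        (((√8)⁻¹ : ℝ) : ℂ) ^ n • tensorPerm (κ := Bits n) σ := by
      ext x y
      have hxy : x = y ∘ σ ↔ ∀ i, (fun s => x s i) = (fun s => y s i) ∘ σ := by
        simp only [funext_iff, Function.comp_apply]
        exact forall_comm
      simp only [vecEquiv_symm_apply, permVec, prodVec, Finset.mem_univ, if_true, qubitPerm,
        Matrix.smul_apply, tensorPerm, Matrix.of_apply, hxy, Finset.prod_ite_zero,
        Finset.prod_const, Finset.card_univ, Fintype.card_fin, true_imp_iff, smul_eq_mul, mul_ite,
        mul_one, mul_zero]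
    simp only [h1]
    exact (tensorPerm_commute σ A).smul_left _
  | zero => rw [map_zero]; exact Commute.zero_left _
  | add x y _ _ hx hy => rw [map_add]; exact hx.add_left hy
  | smul c x _ hx => rw [map_smul]; exact hx.smul_left c

/-! ### Twirls as averages of unitary maps -/

/-- Conjugation by `V^{⊗ 3}`. -/
def conjMap (V : U (Bits n)) : QubitSpace n →ₗ[ℂ] QubitSpace n where
  toFun ψ := vecEquiv (tensorPower 3 V.1 * vecEquiv.symm ψ * tensorPower 3 (V.1)ᴴ)
  map_add' φ ψ := by simp only [map_add, mul_add, add_mul]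
  map_smul' c ψ := by simp only [map_smul, mul_smul_comm, smul_mul_assoc, RingHom.id_apply]

theorem conjMap_vecEquiv (V : U (Bits n)) (X : Matrix (Fin 3 → Bits n) (Fin 3 → Bits n) ℂ) :
    conjMap V (vecEquiv X) = vecEquiv (tensorPower 3 V.1 * X * tensorPower 3 (V.1)ᴴ) := by
  simp [conjMap]

theorem tensorPower_conjTranspose_mul_self (V : U (Bits n)) :
    (tensorPower 3 V.1)ᴴ * tensorPower 3 V.1 = 1 := by
  rw [← tensorPower_conjTranspose, ← tensorPower_mul, ← Matrix.star_eq_conjTranspose,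
    Matrix.mem_unitaryGroup_iff'.1 V.2, tensorPower_one]

theorem conjMap_one (ψ : QubitSpace n) : conjMap 1 ψ = ψ := by
  simp [conjMap, tensorPower_one]

theorem conjMap_mul (V W : U (Bits n)) (ψ : QubitSpace n) :
    conjMap (V * W) ψ = conjMap V (conjMap W ψ) := by
  obtain ⟨X, rfl⟩ := vecEquiv.surjective ψ
  simp only [conjMap_vecEquiv, Submonoid.coe_mul, Matrix.conjTranspose_mul, tensorPower_mul,
    mul_assoc]

theorem inner_conjMap (V : U (Bits n)) (φ ψ : QubitSpace n) :
    inner ℂ (conjMap V φ) (conjMap V ψ) = inner ℂ φ ψ := by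
  obtain ⟨X, rfl⟩ := vecEquiv.surjective φ
  obtain ⟨Y, rfl⟩ := vecEquiv.surjective ψ
  have h := tensorPower_conjTranspose_mul_self V
  rw [conjMap_vecEquiv, conjMap_vecEquiv, inner_vecEquiv, inner_vecEquiv]
  simp only [tensorPower_conjTranspose, Matrix.conjTranspose_mul, Matrix.conjTranspose_conjTranspose]
  set T := tensorPower 3 V.1
  calc (T * (Xᴴ * Tᴴ) * (T * Y * Tᴴ)).trace = (T * (Xᴴ * (Tᴴ * T) * Y) * Tᴴ).trace := by
        simp only [mul_assoc]
    _ = (Xᴴ * Y).trace := by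
        rw [h, mul_one, Matrix.trace_mul_comm, ← mul_assoc, h, one_mul]

theorem norm_conjMap (V : U (Bits n)) (ψ : QubitSpace n) : ‖conjMap V ψ‖ = ‖ψ‖ := by
  rw [@norm_eq_sqrt_re_inner ℂ, @norm_eq_sqrt_re_inner ℂ, inner_conjMap]

theorem conjMap_eq_self_iff (V : U (Bits n)) (ψ : QubitSpace n) :
    conjMap V ψ = ψ ↔ Commute (vecEquiv.symm ψ) (tensorPower 3 V.1) := by
  obtain ⟨X, rfl⟩ := vecEquiv.surjective ψ
  have h := tensorPower_conjTranspose_mul_self V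
  rw [conjMap_vecEquiv, vecEquiv.injective.eq_iff, LinearEquiv.symm_apply_apply,
    tensorPower_conjTranspose]
  constructor
  · intro hX
    have := congrArg (· * tensorPower 3 V.1) hX
    simp only [mul_assoc, h, mul_one] at this
    exact this.symm
  · intro hX
    rw [← hX.eq, mul_assoc, mul_eq_one_comm.1 h, mul_one]

theorem continuous_conjMap (ψ : QubitSpace n) : Continuous fun V : U (Bits n) => conjMap V ψ := by
  have h1 : Continuous fun V : U (Bits n) => tensorPower 3 V.1 := by
    refine continuous_pi fun x => continuous_pi fun y => ?_
    simp only [tensorPower, Matrix.of_apply]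
    exact continuous_finsetProd _ fun s _ =>
      (continuous_apply_apply _ _).comp continuous_subtype_val
  have h2 : Continuous fun V : U (Bits n) =>
      tensorPower 3 V.1 * vecEquiv.symm ψ * tensorPower 3 (V.1)ᴴ := by
    simp only [tensorPower_conjTranspose]
    exact (h1.mul continuous_const).mul h1.matrix_conjTranspose
  refine (PiLp.continuous_toLp 2 _).comp (continuous_pi fun z => ?_)
  exact (continuous_apply_apply _ _).comp h2

theorem integrable_conjMap (μ : Measure (U (Bits n))) [IsFiniteMeasure μ] (ψ : QubitSpace n) :
    Integrable (fun V => conjMap V ψ) μ :=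
  Integrable.of_bound (continuous_conjMap ψ).aestronglyMeasurable ‖ψ‖
    (Filter.Eventually.of_forall fun V => (norm_conjMap V ψ).le)

theorem vecEquiv_twirl (μ : Measure (U (Bits n))) [IsFiniteMeasure μ]
    (X : Matrix (Fin 3 → Bits n) (Fin 3 → Bits n) ℂ) :
    vecEquiv (twirl μ 3 X) = ∫ V, conjMap V (vecEquiv X) ∂μ := by
  ext z
  rw [eval_integral_piLp (fun z => (integrable_conjMap μ (vecEquiv X)).eval_piLp z)]
  simp only [conjMap_vecEquiv]
  rfl

theorem integral_mconv {μ ν : Measure (U (Bits n))} [IsFiniteMeasure μ] [IsFiniteMeasure ν]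
    (ψ : QubitSpace n) :
    ∫ V, conjMap V ψ ∂(μ.mconv ν) = ∫ V, conjMap V (∫ W, conjMap W ψ ∂ν) ∂μ := by
  have hc := continuous_conjMap ψ
  rw [Measure.mconv, integral_map measurable_mul.aemeasurable hc.aestronglyMeasurable,
    integral_prod]
  · refine integral_congr_ae (Filter.Eventually.of_forall fun V => ?_)
    simp only [conjMap_mul]
    exact (LinearMap.toContinuousLinearMap (conjMap V)).integral_comp_comm
      (integrable_conjMap ν ψ)
  · exact Integrable.of_bound (hc.comp continuous_mul).aestronglyMeasurable ‖ψ‖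
      (Filter.Eventually.of_forall fun V => (norm_conjMap _ ψ).le)

/-! ### Haar averages are orthogonal projections -/

section Haar

variable {κ : Type*} [Fintype κ] [DecidableEq κ]

/-- The vectors fixed by conjugation with all `F V`. -/
def fixedSpace (F : U κ → U (Bits n)) : Submodule ℂ (QubitSpace n) :=
  ⨅ V, LinearMap.eqLocus (conjMap (F V)) LinearMap.id

theorem mem_fixedSpace {F : U κ → U (Bits n)} {ψ : QubitSpace n} :
    ψ ∈ fixedSpace F ↔ ∀ V, conjMap (F V) ψ = ψ := by
  simp [fixedSpace, Submodule.mem_iInf, LinearMap.mem_eqLocus]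

/-- The average is fixed by left invariance of Haar measure, and unitarity preserves its pairing
with every fixed vector; these two properties characterise the orthogonal projection. -/
theorem integral_haar_conjMap {F : U κ → U (Bits n)} (hF : Continuous F)
    (hmul : ∀ V W, F (V * W) = F V * F W) (ψ : QubitSpace n) :
    ∫ V, conjMap (F V) ψ ∂(haar κ) = (fixedSpace F).starProjection ψ := by
  have : (haar κ).IsMulLeftInvariant := by unfold haar; infer_instance
  have hint : Integrable (fun V => conjMap (F V) ψ) (haar κ) :=
    Integrable.of_bound ((continuous_conjMap ψ).comp hF).aestronglyMeasurable ‖ψ‖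
      (Filter.Eventually.of_forall fun V => (norm_conjMap _ ψ).le)
  refine (Submodule.eq_starProjection_of_mem_of_inner_eq_zero ?_ ?_).symm
  · rw [mem_fixedSpace]
    intro V
    have h1 := (LinearMap.toContinuousLinearMap (conjMap (F V))).integral_comp_comm hint
    simp only [LinearMap.coe_toContinuousLinearMap'] at h1
    rw [← h1]
    simp only [← conjMap_mul, ← hmul]
    exact integral_mul_left_eq_self (fun W => conjMap (F W) ψ) V
  · intro w hw
    rw [mem_fixedSpace] at hw
    rw [inner_sub_left, sub_eq_zero, ← inner_conj_symm, ← inner_conj_symm (∫ _, _ ∂_) w]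
    congr 1
    have h2 := (innerSL ℂ w).integral_comp_comm hint
    simp only [innerSL_apply_apply] at h2
    rw [← h2]
    have h3 : ∀ V, inner ℂ w (conjMap (F V) ψ) = inner ℂ w ψ := fun V => by
      conv_lhs => rw [← hw V]
      exact inner_conjMap _ _ _
    simp [h3]

end Haar

theorem gate_mul (q : {q : Fin n × Fin n // q.1 ≠ q.2}) (V W : U (Fin 2 × Fin 2)) :
    gate q (V * W) = gate q V * gate q W := by
  refine Subtype.ext ?_
  simp only [gate, Submonoid.coe_mul, onPair_eq_submatrix _ _ q.2, Matrix.submatrix_mul_equiv,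
    ← Matrix.mul_kronecker_mul, one_mul]

theorem continuous_gate (q : {q : Fin n × Fin n // q.1 ≠ q.2}) : Continuous (gate q) := by
  refine Continuous.subtype_mk (continuous_pi fun x => continuous_pi fun y => ?_) _
  simp only [onPair, Matrix.of_apply]
  split_ifs
  · exact (continuous_apply_apply _ _).comp continuous_subtype_val
  · exact continuous_const

theorem integral_stepLaw (ψ : QubitSpace n) :
    ∫ V, conjMap V ψ ∂(stepLaw n) =
      ((Fintype.card {q : Fin n × Fin n // q.1 ≠ q.2} : ℝ)⁻¹) •
        ∑ q : {q : Fin n × Fin n // q.1 ≠ q.2}, (fixedSpace (gate q)).starProjection ψ := by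
  have hc := continuous_conjMap ψ
  rw [stepLaw, integral_smul_measure, integral_finsetSum_measure]
  · rw [ENNReal.toReal_inv, ENNReal.toReal_natCast]
    congr 1
    refine Finset.sum_congr rfl fun q _ => ?_
    rw [integral_map (measurable_gate q).aemeasurable hc.aestronglyMeasurable,
      integral_haar_conjMap (continuous_gate q) (gate_mul q)]
  · intro q _
    have := Measure.isProbabilityMeasure_map (μ := haar (Fin 2 × Fin 2))
      (measurable_gate q).aemeasurable
    exact integrable_conjMap _ ψ

/-! ### Contraction of the random circuit -/

/-- This inclusion alone is needed: enlarging the space only decreases the distance, so the lower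
bound for the pair spans passes to the fixed spaces. -/
theorem fixedSpace_gate_le (q : {q : Fin n × Fin n // q.1 ≠ q.2}) :
    fixedSpace (gate q) ≤ permSpan qubitPerm {q.1.1, q.1.2} := by
  intro ψ hψ
  rw [mem_fixedSpace] at hψ
  exact mem_permSpan_pair q.2 fun V hV => (conjMap_eq_self_iff (gate q ⟨V, hV⟩) ψ).1 (hψ ⟨V, hV⟩)

theorem permSpan_univ_le :
    permSpan qubitPerm (Finset.univ : Finset (Fin n)) ≤ fixedSpace (id : U (Bits n) → U (Bits n)) := by
  intro ψ hψ
  rw [mem_fixedSpace]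
  exact fun V => (conjMap_eq_self_iff V ψ).2 (commute_of_mem_permSpan_univ hψ V.1)

theorem fixedSpace_id_le (q : {q : Fin n × Fin n // q.1 ≠ q.2}) :
    fixedSpace (id : U (Bits n) → U (Bits n)) ≤ fixedSpace (gate q) := by
  intro ψ hψ
  rw [mem_fixedSpace] at hψ ⊢
  exact fun V => hψ (gate q V)

theorem norm_sub_starProjection_anti {E : Type*} [NormedAddCommGroup E] [InnerProductSpace ℂ E]
    {K L : Submodule ℂ E} [K.HasOrthogonalProjection] [L.HasOrthogonalProjection] (h : K ≤ L)
    (x : E) : ‖x - L.starProjection x‖ ≤ ‖x - K.starProjection x‖ := by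
  rw [L.starProjection_minimal x]
  exact ciInf_le ⟨0, by rintro _ ⟨y, rfl⟩; exact norm_nonneg _⟩
    (⟨K.starProjection x, h (K.starProjection_apply_mem x)⟩ : L)

theorem card_pairs : (Fintype.card {q : Fin n × Fin n // q.1 ≠ q.2} : ℝ) = n * (n - 1) := by
  have h : Fintype.card {q : Fin n × Fin n // q.1 ≠ q.2} =
      (Finset.univ : Finset (Fin n)).offDiag.card := by
    rw [Fintype.card_subtype]
    congr 1
    ext q
    simp
  rw [h, Finset.offDiag_card, Finset.card_univ, Fintype.card_fin,
    Nat.cast_sub (Nat.le_mul_self n)]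
  push_cast; ring

/-- The average of the projections contracts the orthogonal complement of the invariants. -/
theorem norm_integral_stepLaw_sq_le (hn : 2 ≤ n) {ψ : QubitSpace n}
    (hψ : ψ ∈ (fixedSpace (id : U (Bits n) → U (Bits n)))ᗮ) :
    ‖∫ V, conjMap V ψ ∂(stepLaw n)‖ ^ 2 ≤ (1 - 1 / (n : ℝ) ^ 2) * ‖ψ‖ ^ 2 := by
  have hn2 : (2 : ℝ) ≤ n := by exact_mod_cast hn
  set c : ℝ := ((Fintype.card {q : Fin n × Fin n // q.1 ≠ q.2} : ℕ) : ℝ) with hc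
  have hcn : c = n * (n - 1) := card_pairs
  have hc0 : 0 < c := by rw [hcn]; exact mul_pos (by linarith) (by linarith)
  have hgap := norm_sub_starProjection_sq_le_pairDefect (p := qubitPerm) sum_qubitPerm
    (ι := Fin n) (by simpa using hn) ψ
  rw [(Submodule.starProjection_apply_eq_zero_iff _).2 (Submodule.orthogonal_le permSpan_univ_le hψ),
    sub_zero, Fintype.card_fin] at hgap
  have hpair : pairDefect qubitPerm Finset.univ ψ ≤ ∑ q : {q : Fin n × Fin n // q.1 ≠ q.2},
      (‖ψ‖ ^ 2 - ‖(fixedSpace (gate q)).starProjection ψ‖ ^ 2) := by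
    rw [pairDefect, Finset.sum_subtype (p := fun q : Fin n × Fin n => q.1 ≠ q.2) _
      (by simp) (fun q => ‖ψ - (permSpan qubitPerm {q.1, q.2}).starProjection ψ‖ ^ 2)]
    refine Finset.sum_le_sum fun q _ => ?_
    have h1 := (fixedSpace (gate q)).norm_sq_eq_add_norm_sq_starProjection ψ
    rw [Submodule.starProjection_orthogonal_val] at h1
    rw [h1, add_sub_cancel_left]
    exact pow_le_pow_left₀ (norm_nonneg _)
      (norm_sub_starProjection_anti (fixedSpace_gate_le q) ψ) 2
  rw [Finset.sum_sub_distrib, Finset.sum_const, nsmul_eq_mul, Finset.card_univ, ← hc] at hpair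
  have hsq : ‖∑ q : {q : Fin n × Fin n // q.1 ≠ q.2}, (fixedSpace (gate q)).starProjection ψ‖ ^ 2 ≤
      c * ∑ q : {q : Fin n × Fin n // q.1 ≠ q.2}, ‖(fixedSpace (gate q)).starProjection ψ‖ ^ 2 := by
    refine (pow_le_pow_left₀ (norm_nonneg _) (norm_sum_le _ _) 2).trans ?_
    rw [hc, ← Finset.card_univ]
    exact sq_sum_le_card_mul_sum_sq
  rw [integral_stepLaw, norm_smul, ← hc, mul_pow, norm_inv, Real.norm_of_nonneg hc0.le, inv_pow,
    inv_mul_le_iff₀ (by positivity)]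
  refine hsq.trans ?_
  -- With `c = n (n - 1)` pairs, a total defect of `(n - 1)/n` is a relative loss of `(n - 1)/(n c)
  -- = 1/n²`.
  have h2 : c ^ 2 * ((1 - 1 / (n : ℝ) ^ 2) * ‖ψ‖ ^ 2) =
      c * (c * ‖ψ‖ ^ 2 - (n - 1) / n * ‖ψ‖ ^ 2) := by
    rw [hcn]; field_simp
  rw [h2]
  exact mul_le_mul_of_nonneg_left (by linarith) hc0.le

theorem integral_stepLaw_mem_orthogonal {ψ : QubitSpace n}
    (hψ : ψ ∈ (fixedSpace (id : U (Bits n) → U (Bits n)))ᗮ) :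
    ∫ V, conjMap V ψ ∂(stepLaw n) ∈ (fixedSpace (id : U (Bits n) → U (Bits n)))ᗮ := by
  rw [integral_stepLaw]
  refine Submodule.smul_of_tower_mem _ _ (Submodule.sum_mem _ fun q _ => ?_)
  rw [Submodule.mem_orthogonal] at hψ ⊢
  intro u hu
  rw [← Submodule.inner_starProjection_left_eq_right,
    Submodule.starProjection_eq_self_iff.2 (fixedSpace_id_le q hu), hψ u hu]

theorem norm_integral_uniformRandomCircuit_sq_le (hn : 2 ≤ n) (k : ℕ) {ψ : QubitSpace n}
    (hψ : ψ ∈ (fixedSpace (id : U (Bits n) → U (Bits n)))ᗮ) :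
    ∫ V, conjMap V ψ ∂(uniformRandomCircuit n k) ∈
        (fixedSpace (id : U (Bits n) → U (Bits n)))ᗮ ∧
      ‖∫ V, conjMap V ψ ∂(uniformRandomCircuit n k)‖ ^ 2 ≤
        (1 - 1 / (n : ℝ) ^ 2) ^ k * ‖ψ‖ ^ 2 := by
  have := isProbabilityMeasure_stepLaw hn
  induction k with
  | zero => simp [uniformRandomCircuit, conjMap_one, hψ]
  | succ k ih =>
    have := isProbabilityMeasure_uniformRandomCircuit hn k
    have hn2 : (1 : ℝ) ≤ n := by exact_mod_cast (by omega : 1 ≤ n)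
    have h0 : 0 ≤ 1 - 1 / (n : ℝ) ^ 2 := by
      rw [sub_nonneg, div_le_one (by positivity)]; exact one_le_pow₀ hn2
    rw [uniformRandomCircuit, integral_mconv]
    refine ⟨integral_stepLaw_mem_orthogonal ih.1,
      (norm_integral_stepLaw_sq_le hn ih.1).trans ?_⟩
    rw [pow_succ' (1 - 1 / (n : ℝ) ^ 2), mul_assoc]
    exact mul_le_mul_of_nonneg_left ih.2 h0

theorem integral_eq_self_of_mem_fixedSpace (μ : Measure (U (Bits n))) [IsProbabilityMeasure μ]
    {ψ : QubitSpace n} (hψ : ψ ∈ fixedSpace (id : U (Bits n) → U (Bits n))) :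
    ∫ V, conjMap V ψ ∂μ = ψ := by
  rw [mem_fixedSpace] at hψ
  simp only [id] at hψ
  simp [hψ]

theorem schattenTwo_twirl_sub_le (hn : 2 ≤ n) (k : ℕ)
    (X : Matrix (Fin 3 → Bits n) (Fin 3 → Bits n) ℂ) :
    schattenTwo (twirl (uniformRandomCircuit n k) 3 X - twirl (haar (Bits n)) 3 X) ^ 2 ≤
      (1 - 1 / (n : ℝ) ^ 2) ^ k * schattenTwo X ^ 2 := by
  have := isProbabilityMeasure_uniformRandomCircuit hn k
  have hn2 : (1 : ℝ) ≤ n := by exact_mod_cast (by omega : 1 ≤ n)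
  have h0 : 0 ≤ 1 - 1 / (n : ℝ) ^ 2 := by
    rw [sub_nonneg, div_le_one (by positivity)]; exact one_le_pow₀ hn2
  set S := fixedSpace (id : U (Bits n) → U (Bits n)) with hS
  set ψ := vecEquiv X with hψ
  have h1 : ∫ V, conjMap V ψ ∂(haar (Bits n)) = S.starProjection ψ :=
    integral_haar_conjMap continuous_id (fun _ _ => rfl) ψ
  have h2 : ∫ V, conjMap V ψ ∂(uniformRandomCircuit n k) - S.starProjection ψ =
      ∫ V, conjMap V (ψ - S.starProjection ψ) ∂(uniformRandomCircuit n k) := by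
    simp only [map_sub]
    rw [integral_sub (integrable_conjMap _ _) (integrable_conjMap _ _),
      integral_eq_self_of_mem_fixedSpace _ (S.starProjection_apply_mem ψ)]
  rw [← norm_vecEquiv, ← norm_vecEquiv, map_sub, vecEquiv_twirl, vecEquiv_twirl, ← hψ, h1, h2]
  refine (norm_integral_uniformRandomCircuit_sq_le hn k
    (S.sub_starProjection_mem_orthogonal ψ)).2.trans ?_
  refine mul_le_mul_of_nonneg_left ?_ (pow_nonneg h0 k)
  have h3 := S.norm_sq_eq_add_norm_sq_starProjection ψ
  rw [Submodule.starProjection_orthogonal_val] at h3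
  nlinarith [sq_nonneg ‖S.starProjection ψ‖]

theorem one_sub_pow_le_sq {n : ℕ} (hn : 2 ≤ n) {ε : ℝ} (hε : 0 < ε) {k : ℕ}
    (hk : 5 * (n : ℝ) ^ 2 * Real.log (1 / ε) ≤ k) : (1 - 1 / (n : ℝ) ^ 2) ^ k ≤ ε ^ 2 := by
  have hn2 : (1 : ℝ) ≤ n := by exact_mod_cast (by omega : 1 ≤ n)
  have hnn : (0 : ℝ) < (n : ℝ) ^ 2 := by positivity
  have h0 : 0 ≤ 1 - 1 / (n : ℝ) ^ 2 := by
    rw [sub_nonneg, div_le_one hnn]; exact one_le_pow₀ hn2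
  have hk0 : (0 : ℝ) ≤ k := Nat.cast_nonneg k
  have h1 : -Real.log ε * 2 ≤ k * (1 / (n : ℝ) ^ 2) := by
    rw [mul_one_div, le_div_iff₀ hnn]
    rw [one_div, Real.log_inv] at hk
    -- Only `k ≥ 2 n² log (1/ε)` is required. For `ε > 1` the logarithm is negative and `k ≥ 0` is
    -- enough.
    by_cases hl : 0 ≤ -Real.log ε
    · nlinarith [mul_nonneg hnn.le hl]
    · nlinarith [mul_nonneg hnn.le (neg_nonneg.2 (not_le.1 hl).le)]
  calc (1 - 1 / (n : ℝ) ^ 2) ^ k ≤ Real.exp (-(1 / (n : ℝ) ^ 2)) ^ k :=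
        pow_le_pow_left₀ h0 (by linarith [Real.add_one_le_exp (-(1 / (n : ℝ) ^ 2))]) k
    _ = Real.exp (k * -(1 / (n : ℝ) ^ 2)) := (Real.exp_nat_mul _ k).symm
    _ ≤ Real.exp (Real.log ε * 2) := Real.exp_le_exp.2 (by linarith)
    _ = ε ^ 2 := by
        rw [mul_comm, ← Nat.cast_ofNat, Real.exp_nat_mul, Real.exp_log hε]

end RandomCircuit

end

theorem mainTheorem10 (n : ℕ) (hn : 2 ≤ n) (ε : ℝ) (hε : 0 < ε) (k : ℕ)
    (hk : 5 * (n : ℝ) ^ 2 * Real.log (1 / ε) ≤ (k : ℝ)) :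
    RandomCircuit.IsApproxUnitaryDesign (RandomCircuit.uniformRandomCircuit n k) 3 ε := by
  refine iSup₂_le fun X _ => ENNReal.ofReal_le_ofReal ?_
  have hX : 0 ≤ RandomCircuit.schattenTwo X := Real.sqrt_nonneg _
  refine div_le_of_le_mul₀ hX hε.le ((sq_le_sq₀ (Real.sqrt_nonneg _) (mul_nonneg hε.le hX)).1 ?_)
  rw [mul_pow]
  exact (RandomCircuit.schattenTwo_twirl_sub_le hn k X).trans
    (mul_le_mul_of_nonneg_right (RandomCircuit.one_sub_pow_le_sq hn hε hk) (sq_nonneg _))
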